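/- Consider the square lattice $\mathbb{Z}^2$ with edges between points at Euclidean distance one. A self-avoiding walk of length $n$ is an injective map $\gamma:\{0,\dots,n\}\to\mathbb{Z}^2$ with $\|\gamma_{i+1}-\gamma_i\|=1$ for all $0 \le i<n$; let $\mathsf{SAW}_n$ be the set of those with $\gamma_0=(0,0)$, and let $\mu=\lim_{n\to\infty}|\mathsf{SAW}_n|^{1/n}$ be the connective constant. For even $m\ge 4$, a self-avoiding polygon of length $m$ is the set of $m$ edges formed by the $m-1$ edges $\{\gamma_i,\gamma_{i+1}\}$ of a self-avoiding walk $\gamma$ of length $m-1$ (with any starting point) with $\|\gamma_{m-1}-\gamma_0\|=1$, together with the edge $\{\gamma_{m-1},\gamma_0\}$. Let $\mathsf{SAP}_m$ be the set of self-avoiding polygons of length $m$, up to translation by vectors of $\mathbb{Z}^2$. Let $p\in\mathsf{SAP}_m$, and let $V\subset\mathbb{Z}^2$ be the vertex set of any representative of $p$. The height of $p$ is $\mathsf{h}(p)=\max\{y(z):z\in V\}-\min\{y(z):z\in V\}$. The line-width of $p$ is $$\mathsf{Lw}(p)=\max\big\{\,\max\{x(z):z\in V\cap\ell_y\}-\min\{x(z):z\in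 V\cap\ell_y\}\;:\;y\in\mathbb{Z},\ V\cap\ell_y\neq\emptyset\,\big\},\qquad \ell_y=\mathbb{Z}\times\{y\}.$$ For a positive integer $u$, the set of wide polygons is $\mathsf{WSAP}^u_m=\{p\in\mathsf{SAP}_m:\ \mathsf{Lw}(p)\ge u,\ \mathsf{h}(p)\le 16u\}$. **Proposition.** For any real $\alpha>29$, there exists an infinite set $A$ of positive integers such that, for every $u\in A$, there exists an even integer $m$ with $4u+4\le m\le 4u^2+4$ for which $$\big|\mathsf{WSAP}^u_m\big|\ \ge\ u^{-\alpha}\,\mu^m .$$ -/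

import Mathlib

open Filter Topology

namespace SquareLattice

/-! ### Self-avoiding walks on the square lattice and the connective constant -/

/-- Nearest-neighbour adjacency on `ℤ²`: the points are at Euclidean distance one. -/
def Adj (a b : ℤ × ℤ) : Prop := (b.1 - a.1) ^ 2 + (b.2 - a.2) ^ 2 = 1

/-- A self-avoiding walk of length `n`: an injective nearest-neighbour walk indexed by
`0, 1, …, n`, with an arbitrary starting point. -/
def IsSAW {n : ℕ} (γ : Fin (n + 1) → ℤ × ℤ) : Prop :=
  (∀ i : Fin n, Adj (γ i.castSucc) (γ i.succ)) ∧ Function.Injective γ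

/-- The set of self-avoiding walks of length `n` that start at the origin. -/
def SAW (n : ℕ) : Set (Fin (n + 1) → ℤ × ℤ) := {γ | IsSAW γ ∧ γ 0 = 0}

/-- The connective constant of the square lattice, `μ = lim_n |SAW_n|^{1/n}`.
(The limit exists: see `tendsto_connectiveConstant` below.) -/
noncomputable def connectiveConstant : ℝ :=
  limUnder atTop fun n : ℕ => ((SAW n).ncard : ℝ) ^ (1 / (n : ℝ))

/-! ### Extremal coordinates, height and line-width of a set of lattice points

For the finite nonempty sets to which they are applied, the `sSup` and `sInf` below are
a maximum and a minimum. -/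

/-- The largest first coordinate of a point of `V`. -/
noncomputable def xMax (V : Set (ℤ × ℤ)) : ℤ := sSup (Prod.fst '' V)

/-- The smallest first coordinate of a point of `V`. -/
noncomputable def xMin (V : Set (ℤ × ℤ)) : ℤ := sInf (Prod.fst '' V)

/-- The largest second coordinate of a point of `V`. -/
noncomputable def yMax (V : Set (ℤ × ℤ)) : ℤ := sSup (Prod.snd '' V)

/-- The smallest second coordinate of a point of `V`. -/
noncomputable def yMin (V : Set (ℤ × ℤ)) : ℤ := sInf (Prod.snd '' V)

/-- The height of `V`. -/
noncomputable def height (V : Set (ℤ × ℤ)) : ℤ := yMax V - yMin V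

/-- The horizontal line `ℤ × {y}`. -/
def hline (y : ℤ) : Set (ℤ × ℤ) := {z | z.2 = y}

/-- The line-width of `V`: the maximum, over the horizontal lines that meet `V`, of the distance
between the leftmost and the rightmost points of `V` on the line. -/
noncomputable def lineWidth (V : Set (ℤ × ℤ)) : ℤ :=
  sSup {w | ∃ y : ℤ, (V ∩ hline y).Nonempty ∧ w = xMax (V ∩ hline y) - xMin (V ∩ hline y)}

/-! ### Self-avoiding polygons -/

/-- The edges joining consecutive points of `γ`, together with the edge that joins the
last point to the first. -/
def closedTrace {n : ℕ} (γ : Fin (n + 1) → ℤ × ℤ) : Set (Sym2 (ℤ × ℤ)) :=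
  Set.range (fun i : Fin n => s(γ i.castSucc, γ i.succ)) ∪ {s(γ (Fin.last n), γ 0)}

/-- `P` is (the edge set of) a self-avoiding polygon of length `m`: it is obtained from a closing
self-avoiding walk, of length `n = m - 1`, by adding the edge between the endpoints of the walk.
The condition `1 < n` excludes the degenerate polygon of length two, a doubled edge. -/
def IsPolygon (m : ℕ) (P : Set (Sym2 (ℤ × ℤ))) : Prop :=
  ∃ n : ℕ, 1 < n ∧ n + 1 = m ∧ ∃ γ : Fin (n + 1) → ℤ × ℤ,
    IsSAW γ ∧ Adj (γ (Fin.last n)) (γ 0) ∧ P = closedTrace γ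

/-- Self-avoiding polygons of length `m`, before identification of translates. -/
abbrev Polygon (m : ℕ) : Type := {P : Set (Sym2 (ℤ × ℤ)) // IsPolygon m P}

/-- The set of endpoints of the edges in `P`. -/
def vertices (P : Set (Sym2 (ℤ × ℤ))) : Set (ℤ × ℤ) := {z | ∃ e ∈ P, z ∈ e}

/-- The translate of a set of edges by the vector `v`. -/
def translate (v : ℤ × ℤ) (P : Set (Sym2 (ℤ × ℤ))) : Set (Sym2 (ℤ × ℤ)) :=
  Sym2.map (fun z => v + z) '' P

theorem translate_zero (P : Set (Sym2 (ℤ × ℤ))) : translate 0 P = P := by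
  simp [translate]

theorem translate_translate (v w : ℤ × ℤ) (P : Set (Sym2 (ℤ × ℤ))) :
    translate v (translate w P) = translate (v + w) P := by
  simp only [translate, Set.image_image, Sym2.map_map]
  congr 1
  ext e
  simp [add_assoc]

/-- Two polygons are identified if one is a translate of the other. -/
instance polygonSetoid (m : ℕ) : Setoid (Polygon m) where
  r P Q := ∃ v : ℤ × ℤ, Q.1 = translate v P.1
  iseqv :=
    { refl := fun P => ⟨0, (translate_zero P.1).symm⟩
      symm := by
        rintro P Q ⟨v, h⟩
        exact ⟨-v, by rw [h, translate_translate, neg_add_cancel, translate_zero]⟩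
      trans := by
        rintro P Q R ⟨v, h⟩ ⟨w, h'⟩
        exact ⟨w + v, by rw [h', h, translate_translate]⟩ }

/-- Self-avoiding polygons of length `m` up to translation. -/
abbrev SAP (m : ℕ) : Type := Quotient (polygonSetoid m)

/-! ### Height and line-width are invariant under translation -/

theorem vertices_translate (v : ℤ × ℤ) (P : Set (Sym2 (ℤ × ℤ))) :
    vertices (translate v P) = (fun z => v + z) '' vertices P := by
  ext z
  simp only [vertices, translate, Set.mem_ofPred_eq, Set.mem_image]
  constructor
  · rintro ⟨_, ⟨e, he, rfl⟩, hz⟩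
    obtain ⟨a, ha, rfl⟩ := Sym2.mem_map.1 hz
    exact ⟨a, ⟨e, he, ha⟩, rfl⟩
  · rintro ⟨a, ⟨e, he, ha⟩, rfl⟩
    exact ⟨_, ⟨e, he, rfl⟩, Sym2.mem_map.2 ⟨a, ha, rfl⟩⟩

theorem IsPolygon.finite_vertices {m : ℕ} {P : Set (Sym2 (ℤ × ℤ))} (h : IsPolygon m P) :
    (vertices P).Finite := by
  obtain ⟨n, -, -, γ, -, -, rfl⟩ := h
  refine (Set.finite_range γ).subset ?_
  rintro z ⟨e, (⟨i, rfl⟩ | rfl), hz⟩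
  · rcases Sym2.mem_iff.1 hz with rfl | rfl <;> exact ⟨_, rfl⟩
  · rcases Sym2.mem_iff.1 hz with rfl | rfl <;> exact ⟨_, rfl⟩

theorem IsPolygon.nonempty_vertices {m : ℕ} {P : Set (Sym2 (ℤ × ℤ))} (h : IsPolygon m P) :
    (vertices P).Nonempty := by
  obtain ⟨n, -, -, γ, -, -, rfl⟩ := h
  exact ⟨γ 0, s(γ (Fin.last n), γ 0), Or.inr rfl, Sym2.mem_mk_right _ _⟩

theorem sSup_add_image (c : ℤ) {S : Set ℤ} (hS : S.Finite) (hne : S.Nonempty) :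
    sSup ((fun x => c + x) '' S) = c + sSup S :=
  ((OrderIso.addLeft c).map_csSup' hne hS.bddAbove).symm

theorem sInf_add_image (c : ℤ) {S : Set ℤ} (hS : S.Finite) (hne : S.Nonempty) :
    sInf ((fun x => c + x) '' S) = c + sInf S :=
  ((OrderIso.addLeft c).map_csInf' hne hS.bddBelow).symm

theorem xMax_sub_xMin_add (v : ℤ × ℤ) {V : Set (ℤ × ℤ)} (hV : V.Finite) (hne : V.Nonempty) :
    xMax ((fun z => v + z) '' V) - xMin ((fun z => v + z) '' V) = xMax V - xMin V := by
  have h : Prod.fst '' ((fun z => v + z) '' V) = (fun x => v.1 + x) '' (Prod.fst '' V) := by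
    simp only [Set.image_image, Prod.fst_add]
  rw [xMax, xMin, h, sSup_add_image _ (hV.image _) (hne.image _),
    sInf_add_image _ (hV.image _) (hne.image _), xMax, xMin]
  ring

theorem height_add (v : ℤ × ℤ) {V : Set (ℤ × ℤ)} (hV : V.Finite) (hne : V.Nonempty) :
    height ((fun z => v + z) '' V) = height V := by
  have h : Prod.snd '' ((fun z => v + z) '' V) = (fun x => v.2 + x) '' (Prod.snd '' V) := by
    simp only [Set.image_image, Prod.snd_add]
  rw [height, yMax, yMin, h, sSup_add_image _ (hV.image _) (hne.image _),
    sInf_add_image _ (hV.image _) (hne.image _), height, yMax, yMin]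
  ring

theorem lineWidth_add (v : ℤ × ℤ) {V : Set (ℤ × ℤ)} (hV : V.Finite) :
    lineWidth ((fun z => v + z) '' V) = lineWidth V := by
  have h : ∀ y : ℤ, ((fun z => v + z) '' V) ∩ hline (v.2 + y) =
      (fun z => v + z) '' (V ∩ hline y) := by
    intro y
    ext z
    constructor
    · rintro ⟨⟨a, ha, rfl⟩, hy⟩
      exact ⟨a, ⟨ha, by simpa [hline] using hy⟩, rfl⟩
    · rintro ⟨a, ⟨ha, hy⟩, rfl⟩
      exact ⟨⟨a, ha, rfl⟩, by simpa [hline] using hy⟩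
  have hfin : ∀ y : ℤ, (V ∩ hline y).Finite := fun y => hV.subset Set.inter_subset_left
  unfold lineWidth
  congr 1
  ext w
  constructor
  · rintro ⟨y, hy, rfl⟩
    obtain ⟨y, rfl⟩ : ∃ y', y = v.2 + y' := ⟨y - v.2, by ring⟩
    rw [h] at hy ⊢
    exact ⟨y, hy.of_image, xMax_sub_xMin_add v (hfin y) hy.of_image⟩
  · rintro ⟨y, hy, rfl⟩
    refine ⟨v.2 + y, ?_, ?_⟩
    · rw [h]; exact hy.image _
    · rw [h, xMax_sub_xMin_add v (hfin y) hy]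

/-! ### Wide polygons -/

/-- The height of a polygon, that is, of the vertex set of any representative. -/
noncomputable def SAP.height {m : ℕ} (p : SAP m) : ℤ :=
  Quotient.lift (fun P : Polygon m => SquareLattice.height (vertices P.1)) (by
    rintro P Q ⟨v, h⟩
    simp only [h, vertices_translate]
    exact (height_add v P.2.finite_vertices P.2.nonempty_vertices).symm) p

/-- The line-width of a polygon, that is, of the vertex set of any representative. -/
noncomputable def SAP.lineWidth {m : ℕ} (p : SAP m) : ℤ :=
  Quotient.lift (fun P : Polygon m => SquareLattice.lineWidth (vertices P.1)) (by
    rintro P Q ⟨v, h⟩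
    simp only [h, vertices_translate]
    exact (lineWidth_add v P.2.finite_vertices).symm) p

/-- The set of wide polygons of length `m`: those of line-width at least `u` and of height at
most `16 u`. -/
def WSAP (m u : ℕ) : Set (SAP m) := {p | (u : ℤ) ≤ p.lineWidth ∧ p.height ≤ 16 * (u : ℤ)}

/-! ### Finiteness of the sets that are counted, and existence of the limit that defines the
connective constant -/

theorem abs_sub_le_of_adj {a b : ℤ × ℤ} (h : Adj a b) : |b.1 - a.1| ≤ 1 ∧ |b.2 - a.2| ≤ 1 := by
  unfold Adj at h
  constructor <;> rw [abs_le] <;> constructor <;> nlinarith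

theorem SAW_finite (n : ℕ) : (SAW n).Finite := by
  have hbd : ∀ γ ∈ SAW n, ∀ k : ℕ, ∀ hk : k < n + 1,
      |(γ ⟨k, hk⟩).1| ≤ k ∧ |(γ ⟨k, hk⟩).2| ≤ k := by
    intro γ hγ k
    induction k with
    | zero =>
      intro hk
      have : γ ⟨0, hk⟩ = 0 := hγ.2
      rw [this]
      simp
    | succ k ih =>
      intro hk
      have h1 := ih (by omega)
      have h2 := abs_sub_le_of_adj (hγ.1.1 ⟨k, by omega⟩)
      simp only [Fin.castSucc_mk, Fin.succ_mk] at h2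
      simp only [abs_le] at h1 h2 ⊢
      push_cast
      omega
  refine (Set.Finite.pi (t := fun _ : Fin (n + 1) =>
    Set.Icc ((-(n : ℤ), -(n : ℤ)) : ℤ × ℤ) ((n : ℤ), (n : ℤ)))
    fun _ => Set.finite_Icc _ _).subset ?_
  intro γ hγ i _
  have h := hbd γ hγ i.1 i.2
  have hi := i.2
  simp only [abs_le, Fin.eta] at h
  refine ⟨⟨?_, ?_⟩, ⟨?_, ?_⟩⟩ <;> simp only <;> omega

/-- Up to translation, there are finitely many self-avoiding polygons of a given length. -/
theorem SAP_finite (m : ℕ) : Finite (SAP m) := by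
  classical
  let E : SAP m → Set (Set (Sym2 (ℤ × ℤ))) := fun p => {P | ∃ h : IsPolygon m P, ⟦⟨P, h⟩⟧ = p}
  have key : ∀ p : SAP m, ∃ γ ∈ SAW (m - 1), closedTrace γ ∈ E p := by
    intro p
    induction p using Quotient.inductionOn with
    | h P =>
      obtain ⟨P, n, hn, rfl, γ, ⟨hγ, hinj⟩, hc, rfl⟩ := P
      have hγ' : IsSAW fun i => -γ 0 + γ i :=
        ⟨fun i => by simpa [Adj] using hγ i, fun i j h => hinj (add_right_injective _ h)⟩
      refine ⟨fun i => -γ 0 + γ i, ⟨hγ', by simp⟩, ⟨n, hn, rfl, _, hγ', ?_, rfl⟩, ?_⟩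
      · simpa [Adj, neg_add_eq_sub] using hc
      · refine Quotient.sound ⟨γ 0, ?_⟩
        simp only [translate, closedTrace, Set.image_union, Set.image_singleton, ← Set.range_comp]
        simp [Function.comp_def]
  choose g hg hE using key
  have := (SAW_finite (m - 1)).to_subtype
  refine Finite.of_injective (fun p => (⟨g p, hg p⟩ : SAW (m - 1))) fun p q h => ?_
  have h' : g p = g q := congrArg Subtype.val h
  obtain ⟨h1, h2⟩ := hE p
  obtain ⟨h3, h4⟩ := hE q
  rw [← h2, ← h4]
  congr 2
  rw [h']

theorem SAW_nonempty (n : ℕ) : (SAW n).Nonempty := by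
  refine ⟨fun i => ((i : ℕ), 0), ⟨fun i => ?_, fun i j h => ?_⟩, ?_⟩
  · simp [Adj]
  · simpa [Fin.ext_iff] using h
  · simp

theorem SAW_ncard_pos (n : ℕ) : 0 < (SAW n).ncard :=
  (Set.ncard_pos (SAW_finite n)).2 (SAW_nonempty n)

theorem SAW_ncard_add_le (m n : ℕ) :
    (SAW (m + n)).ncard ≤ (SAW m).ncard * (SAW n).ncard := by
  rw [← Set.ncard_prod]
  let f : (Fin (m + n + 1) → ℤ × ℤ) → (Fin (m + 1) → ℤ × ℤ) × (Fin (n + 1) → ℤ × ℤ) :=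
    fun γ => (fun i => γ ⟨i, by omega⟩, fun i => γ ⟨m + i, by omega⟩ - γ ⟨m, by omega⟩)
  refine Set.ncard_le_ncard_of_injOn f ?_ ?_ ((SAW_finite m).prod (SAW_finite n))
  · rintro γ ⟨⟨h1, h2⟩, h3⟩
    refine ⟨⟨⟨fun i => ?_, fun i j h => ?_⟩, ?_⟩, ⟨⟨fun i => ?_, fun i j h => ?_⟩, ?_⟩⟩
    · exact h1 ⟨i, by omega⟩
    · have := h2 h
      simpa [Fin.ext_iff] using this
    · exact h3
    · have := h1 ⟨m + i, by omega⟩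
      simpa [f, Adj, add_assoc] using this
    · have := h2 (sub_left_injective h)
      simpa [Fin.ext_iff] using this
    · simp [f]
  · intro γ hγ γ' hγ' h
    obtain ⟨ha, hb⟩ := Prod.ext_iff.1 h
    have hm : γ ⟨m, by omega⟩ = γ' ⟨m, by omega⟩ := congrFun ha (Fin.last m)
    funext i
    rcases le_total (i : ℕ) m with hi | hi
    · exact congrFun ha ⟨i, by omega⟩
    · have := congrFun hb ⟨i - m, by omega⟩
      simp only [f, hm, sub_left_inj] at this
      simpa [Nat.add_sub_cancel' hi] using this

theorem tendsto_connectiveConstant :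
    Tendsto (fun n : ℕ => ((SAW n).ncard : ℝ) ^ (1 / (n : ℝ))) atTop (𝓝 connectiveConstant) := by
  have hpos : ∀ n, (0 : ℝ) < (SAW n).ncard := fun n => by exact_mod_cast SAW_ncard_pos n
  have hsub : Subadditive fun n : ℕ => Real.log (SAW n).ncard := by
    intro m n
    rw [← Real.log_mul (hpos m).ne' (hpos n).ne']
    exact Real.log_le_log (hpos _) (by exact_mod_cast SAW_ncard_add_le m n)
  have hlim := hsub.tendsto_lim ⟨0, by
    rintro _ ⟨n, rfl⟩
    exact div_nonneg (Real.log_nonneg (by exact_mod_cast SAW_ncard_pos n)) (Nat.cast_nonneg n)⟩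
  refine tendsto_nhds_limUnder ⟨Real.exp hsub.lim, ?_⟩
  refine ((Real.continuous_exp.tendsto _).comp hlim).congr fun n => ?_
  rw [Function.comp_apply, Real.rpow_def_of_pos (hpos n), mul_one_div]

end SquareLattice

namespace SquareLattice

open scoped ENNReal

/-! ### Walks as eventually constant sequences -/

/-! By the Hammersley–Welsh argument the bridge generating function diverges at 1/μ
(`genFun_isBridge_eq_top`). Hence for each s > 1 there are infinitely many n with at least n^(-s)
μ^n bridges of length n (`frequently_le_ncard_isBridge`). Four such bridges are assembled into a
polygon of length 4n + 4, with only polynomial losses.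

A bridge of span X and vertical oscillation Y gets the scale u = max(X, Y + 1), and then u ≤ n ≤ u².
A weighted pigeonhole fixes u and X (`exists_ncard_bridgeClass_ge`). Two bridges of this class with
a common endpoint, one of them mirrored, join into a bridge whose ends have equal height. Its cyclic
shift to a lowest point is an arc in the upper half-plane over a segment of length D = 2X + 1
(`exists_isArc_cyclicShift`), and Cauchy–Schwarz supplies the pairs (`sq_ncard_bridgeClass_le`).

Two arcs, one reflected to lie below the other, close up into a polygon (`sq_ncard_isArc_le`). If X
= u, the segment already makes it wide. If X < u, one arc rises to height u - 1 above the segment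
while the other crosses the same column below it, so exchanging the coordinates gives line-width u.

The total cost is a constant times u^20 (`exists_ncard_isBridge_pow_le`), and n^(-4s) ≥ u^(-8s). For
s close to 1 the exponent 20 + 8s is below 29, and the spare power absorbs constants. Since u ≥ √n,
unboundedly many scales occur. -/

/-- A self-avoiding walk of length `n` from the origin, extended to all times by remaining at its
endpoint. -/
structure IsWalk (n : ℕ) (γ : ℕ → ℤ × ℤ) : Prop where
  zero : γ 0 = 0
  adj : ∀ i < n, Adj (γ i) (γ (i + 1))
  inj : ∀ i j, i ≤ n → j ≤ n → γ i = γ j → i = j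
  const : ∀ i, n ≤ i → γ i = γ n

/-- Walks that stay strictly to the right of the origin after time zero. -/
structure IsHalfWalk (n : ℕ) (γ : ℕ → ℤ × ℤ) : Prop extends IsWalk n γ where
  pos : ∀ i, 0 < i → i ≤ n → 0 < (γ i).1

/-- Half-plane walks that end at a rightmost point. -/
structure IsBridge (n : ℕ) (γ : ℕ → ℤ × ℤ) : Prop extends IsHalfWalk n γ where
  le_last : ∀ i ≤ n, (γ i).1 ≤ (γ n).1

theorem setOf_isWalk_finite (n : ℕ) : {γ | IsWalk n γ}.Finite := by
  refine Set.Finite.of_injOn (f := fun γ (i : Fin (n + 1)) => γ i) (t := SAW n) ?_ ?_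
    (SAW_finite n)
  · intro γ h
    exact ⟨⟨fun i => by simpa using h.adj i i.2,
      fun i j hij => Fin.ext (h.inj i j (by omega) (by omega) hij)⟩, by simpa using h.zero⟩
  · intro γ h γ' h' e
    have key : ∀ i ≤ n, γ i = γ' i := fun i hi => congrFun e ⟨i, by omega⟩
    funext i
    rcases le_total i n with hi | hi
    · exact key i hi
    · rw [h.const i hi, h'.const i hi, key n le_rfl]

theorem ncard_SAW_le (n : ℕ) : (SAW n).ncard ≤ {γ | IsWalk n γ}.ncard := by
  refine Set.ncard_le_ncard_of_injOn (fun σ i => σ ⟨min i n, by omega⟩) ?_ ?_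
    (setOf_isWalk_finite n)
  · rintro σ ⟨⟨h1, h2⟩, h3⟩
    refine ⟨by simpa using h3, fun i hi => ?_, fun i j hi hj e => ?_, fun i hi => by simp [hi]⟩
    · have := h1 ⟨i, hi⟩
      simpa [min_eq_left hi.le, min_eq_left (Nat.succ_le_of_lt hi)] using this
    · simpa [Fin.ext_iff, min_eq_left hi, min_eq_left hj] using h2 e
  · intro σ _ σ' _ e
    funext i
    have := congrFun e i
    simpa [min_eq_left (Nat.le_of_lt_succ i.2)] using this

theorem setOf_isBridge_finite (n : ℕ) : {γ | IsBridge n γ}.Finite :=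
  (setOf_isWalk_finite n).subset fun _ h => h.toIsWalk

theorem IsWalk.abs_le {n : ℕ} {γ : ℕ → ℤ × ℤ} (h : IsWalk n γ) (i : ℕ) :
    ∀ d, i + d ≤ n → |(γ (i + d)).1 - (γ i).1| ≤ d ∧ |(γ (i + d)).2 - (γ i).2| ≤ d := by
  intro d
  induction d with
  | zero => simp
  | succ d ih =>
    intro hd
    have h1 := ih (by omega)
    have h2 := abs_sub_le_of_adj (h.adj (i + d) (by omega))
    rw [← add_assoc]
    simp only [_root_.abs_le] at h1 h2 ⊢
    push_cast
    omega

/-- Walks are cut at the last time of an extremum: the strict inequality afterwards is what makes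
the remaining piece a half-plane walk. Maxima are handled by negating `f`. -/
theorem exists_last_min (f : ℕ → ℤ) (n : ℕ) :
    ∃ k ≤ n, (∀ i ≤ n, f k ≤ f i) ∧ ∀ i, k < i → i ≤ n → f k < f i := by
  induction n with
  | zero => exact ⟨0, le_rfl, by simp, by omega⟩
  | succ n ih =>
    obtain ⟨k, hk, h1, h2⟩ := ih
    by_cases h : f (n + 1) ≤ f k
    · refine ⟨n + 1, le_rfl, fun i hi => ?_, by omega⟩
      rcases Nat.le_or_eq_of_le_succ hi with hi | rfl
      · exact h.trans (h1 i hi)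
      · exact le_rfl
    · refine ⟨k, by omega, fun i hi => ?_, fun i hki hi => ?_⟩
      · rcases Nat.le_or_eq_of_le_succ hi with hi | rfl
        · exact h1 i hi
        · exact (not_le.1 h).le
      · rcases Nat.le_or_eq_of_le_succ hi with hi | rfl
        · exact h2 i hki hi
        · exact not_le.1 h

/-! ### Generating functions and the Hammersley–Welsh argument -/

/-- The generating function of a family of sets indexed by length. -/
noncomputable def genFun (P : ℕ → Set (ℕ → ℤ × ℤ)) (z : ℝ≥0∞) : ℝ≥0∞ :=
  ∑' p : Σ n, P n, z ^ p.1

theorem genFun_eq_tsum_ncard {P : ℕ → Set (ℕ → ℤ × ℤ)} (hP : ∀ n, (P n).Finite) (z : ℝ≥0∞) :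
    genFun P z = ∑' n, ((P n).ncard : ℝ≥0∞) * z ^ n := by
  rw [genFun, ENNReal.tsum_sigma']
  refine tsum_congr fun n => ?_
  simp only
  rw [ENNReal.tsum_const, ENat.card_coe_set_eq, ← (hP n).cast_ncard_eq]
  simp

theorem genFun_mono {P Q : ℕ → Set (ℕ → ℤ × ℤ)} (h : ∀ n, P n ⊆ Q n) (z : ℝ≥0∞) :
    genFun P z ≤ genFun Q z := by
  let f : (Σ n, P n) → Σ n, Q n := fun p => ⟨p.1, p.2.1, h _ p.2.2⟩
  have hf : Function.Injective f := by
    rintro ⟨n, γ, hγ⟩ ⟨n', γ', hγ'⟩ e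
    simp only [f, Sigma.mk.injEq] at e
    obtain ⟨rfl, e⟩ := e
    simpa using e
  exact ENNReal.tsum_comp_le_tsum_of_injective hf fun q => z ^ q.1

theorem genFun_union_le (P Q : ℕ → Set (ℕ → ℤ × ℤ)) (z : ℝ≥0∞) :
    genFun (fun n => P n ∪ Q n) z ≤ genFun P z + genFun Q z := by
  simp only [genFun, ENNReal.tsum_sigma']
  rw [← ENNReal.tsum_add]
  exact ENNReal.tsum_le_tsum fun n => ENNReal.tsum_union_le (fun _ => z ^ n) _ _

/-- If each element of `P` is reconstructed from a pair in `Q × R` whose total length exceeds its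
own by `c`, the generating functions compare. -/
theorem pow_mul_genFun_le {P Q R : ℕ → Set (ℕ → ℤ × ℤ)} {c : ℕ}
    (G : ℕ → (ℕ → ℤ × ℤ) → ℕ → (ℕ → ℤ × ℤ) → ℕ → ℤ × ℤ)
    (h : ∀ n, ∀ γ ∈ P n, ∃ k l a b, a ∈ Q k ∧ b ∈ R l ∧ k + l = n + c ∧ γ = G k a l b)
    (z : ℝ≥0∞) : z ^ c * genFun P z ≤ genFun Q z * genFun R z := by
  choose! k l a b ha hb hkl hG using h
  let f : (Σ n, P n) → (Σ n, Q n) × (Σ n, R n) := fun p =>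
    (⟨k p.1 p.2, a p.1 p.2, ha _ _ p.2.2⟩, ⟨l p.1 p.2, b p.1 p.2, hb _ _ p.2.2⟩)
  have hf : Function.Injective f := by
    rintro ⟨n, γ, hγ⟩ ⟨n', γ', hγ'⟩ e
    have g2 := congrArg (fun q => (q.1.2 : ℕ → ℤ × ℤ)) e
    have g4 := congrArg (fun q => (q.2.2 : ℕ → ℤ × ℤ)) e
    simp only [f, Prod.mk.injEq, Sigma.mk.injEq] at e g2 g4
    obtain ⟨⟨e1, -⟩, e3, -⟩ := e
    have hn : n = n' := by
      have h1 := hkl n γ hγ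
      have h2 := hkl n' γ' hγ'
      omega
    subst hn
    have hγγ : γ = γ' := by
      rw [hG n γ hγ, hG n γ' hγ', e1, g2, e3, g4]
    subst hγγ
    rfl
  calc z ^ c * genFun P z = ∑' p : Σ n, P n, z ^ (f p).1.1 * z ^ (f p).2.1 := by
        rw [genFun, ← ENNReal.tsum_mul_left]
        refine tsum_congr fun p => ?_
        rw [← pow_add, ← pow_add, add_comm c, ← hkl p.1 p.2 p.2.2]
    _ ≤ ∑' q : (Σ n, Q n) × (Σ n, R n), z ^ q.1.1 * z ^ q.2.1 :=
        ENNReal.tsum_comp_le_tsum_of_injective hf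
          fun q : (Σ n, Q n) × (Σ n, R n) => z ^ q.1.1 * z ^ q.2.1
    _ = genFun Q z * genFun R z := by
        rw [ENNReal.tsum_prod', genFun, genFun, ← ENNReal.tsum_mul_right]
        exact tsum_congr fun q => ENNReal.tsum_mul_left (a := z ^ q.1)

/-- Half-plane walks of span at most `T`. -/
def halfWalks (T : ℕ) (n : ℕ) : Set (ℕ → ℤ × ℤ) :=
  {γ | IsHalfWalk n γ ∧ ∀ i ≤ n, (γ i).1 ≤ T}

/-- Bridges of span `T`. -/
def bridgesOfSpan (T : ℕ) (n : ℕ) : Set (ℕ → ℤ × ℤ) := {γ | IsBridge n γ ∧ (γ n).1 = T}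

/-- Cut the walk at its last leftmost point. The later piece is a half-plane walk. The earlier
piece, reversed, may return to its starting column, so a horizontal step is prepended to it; this
extra step is the factor `z ^ 1`. -/
theorem genFun_walks_le (z : ℝ≥0∞) :
    z ^ 1 * genFun (fun n => {γ | IsWalk n γ}) z ≤
      genFun (fun n => {γ | IsHalfWalk n γ}) z * genFun (fun n => {γ | IsHalfWalk n γ}) z := by
  refine pow_mul_genFun_le (fun k a _ b i =>
    if i ≤ k - 1 then a (k - i) - a k else b (i - (k - 1)) + ((1, 0) - a k)) ?_ z
  intro n γ h
  obtain ⟨k, hk, h1, h2⟩ := exists_last_min (fun i => (γ i).1) n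
  refine ⟨k + 1, n - k, fun i => if i = 0 then 0 else (1, 0) + γ (k + 1 - i) - γ k,
    fun i => γ (k + i) - γ k, ⟨⟨by simp, fun i hi => ?_, fun i j hi hj e => ?_, fun i hi => ?_⟩,
      fun i h0 hi => ?_⟩, ⟨⟨by simp, fun i hi => ?_, fun i j hi hj e => ?_, fun i hi => ?_⟩,
      fun i h0 hi => ?_⟩, by omega, ?_⟩
  · rcases Nat.eq_zero_or_pos i with rfl | h0
    · simp [Adj]
    · have := h.adj (k - i) (by omega)
      have e : k + 1 - i = k - i + 1 := by omega
      simp only [h0.ne', if_false, Adj, e, Nat.add_eq_zero_iff, one_ne_zero, and_false,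
        Nat.add_sub_add_right] at this ⊢
      simp only [Prod.fst_add, Prod.fst_sub, Prod.snd_add, Prod.snd_sub]
      linarith
  · by_contra hij
    wlog hlt : i < j generalizing i j
    · exact this j i hj hi e.symm (Ne.symm hij) (by omega)
    rcases Nat.eq_zero_or_pos i with rfl | h0
    · have h3 := congrArg Prod.fst e
      have h4 := h1 (k + 1 - j) (by omega)
      simp [hlt.ne'] at h3
      omega
    · simp only [h0.ne', (h0.trans hlt).ne', if_false] at e
      have := h.inj _ _ (by omega) (by omega) (add_left_cancel (sub_left_injective e))
      omega
  · have : i ≠ 0 := by omega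
    simp only [this, if_false]
    have e : k + 1 - i = 0 := by omega
    simp [e]
  · have h4 := h1 (k + 1 - i) (by omega)
    simp only [h0.ne', if_false, Prod.fst_add, Prod.fst_sub]
    omega
  · have := h.adj (k + i) (by omega)
    simpa [Adj, add_assoc] using this
  · have := h.inj _ _ (by omega) (by omega) (sub_left_injective e)
    omega
  · simp only [h.const (k + i) (by omega), h.const (k + (n - k)) (by omega)]
  · have := h2 (k + i) (by omega) (by omega)
    simpa using this
  · have h0 := h.zero
    funext i
    simp only [Nat.add_sub_cancel, Nat.add_eq_zero_iff, one_ne_zero, and_false, if_false,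
      Nat.sub_self, h0]
    split_ifs with hi hi'
    · omega
    · rw [show k + 1 - (k + 1 - i) = i by omega]
      ext <;> simp
    · rw [show k + (i - k) = i by omega]
      ext <;> simp

/-- A walk that reaches column T + 1 is cut at its last visit there: a bridge of span T + 1 comes
first, and the remainder, reflected, is a half-plane walk of span at most T, because it avoids
column 0. The summand 1 accounts for walks that never reach column T + 1. -/
theorem genFun_halfWalks_succ_le (T : ℕ) (z : ℝ≥0∞) :
    genFun (halfWalks (T + 1)) z ≤
      (1 + genFun (bridgesOfSpan (T + 1)) z) * genFun (halfWalks T) z := by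
  let P : ℕ → Set (ℕ → ℤ × ℤ) := fun n =>
    {γ | γ ∈ halfWalks (T + 1) n ∧ ∃ i ≤ n, (γ i).1 = (T + 1 : ℕ)}
  have hP : z ^ 0 * genFun P z ≤ genFun (bridgesOfSpan (T + 1)) z * genFun (halfWalks T) z := by
    refine pow_mul_genFun_le (fun k a _ b i =>
      if i ≤ k then a i else ((a k).1 - (b (i - k)).1, (a k).2 + (b (i - k)).2)) ?_ z
    rintro n γ ⟨⟨h, hT⟩, i₀, hi₀, hi₀'⟩
    obtain ⟨k, hk, h1, h2⟩ := exists_last_min (fun i => -(γ i).1) n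
    have hkT : (γ k).1 = (T + 1 : ℕ) := by
      have h3 := h1 i₀ hi₀
      have h4 := hT k hk
      omega
    refine ⟨k, n - k, fun i => γ (min i k), fun i => ((γ k).1 - (γ (k + i)).1,
      (γ (k + i)).2 - (γ k).2), ⟨⟨⟨⟨by simpa using h.zero, fun i hi => ?_, fun i j hi hj e => ?_,
      fun i hi => by simp [hi]⟩, fun i h0 hi => ?_⟩, fun i hi => ?_⟩, by simpa using hkT⟩,
      ⟨⟨⟨by simp, fun i hi => ?_, fun i j hi hj e => ?_, fun i hi => ?_⟩, fun i h0 hi => ?_⟩,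
      fun i hi => ?_⟩, by omega, ?_⟩
    · have := h.adj i (by omega)
      simpa [min_eq_left hi.le, min_eq_left (Nat.succ_le_of_lt hi)] using this
    · simp only [min_eq_left hi, min_eq_left hj] at e
      exact h.inj _ _ (by omega) (by omega) e
    · simp only [min_eq_left hi]
      exact h.pos i h0 (by omega)
    · have := h1 i (by omega)
      simpa [min_eq_left hi] using this
    · have := h.adj (k + i) (by omega)
      simp only [Adj, ← add_assoc] at this ⊢
      linarith
    · have : γ (k + i) = γ (k + j) := by
        simp only [Prod.mk.injEq] at e
        exact Prod.ext (by omega) (by omega)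
      have := h.inj _ _ (by omega) (by omega) this
      omega
    · simp only [h.const (k + i) (by omega), h.const (k + (n - k)) (by omega)]
    · have := h2 (k + i) (by omega) (by omega)
      simp only at this ⊢
      omega
    · rcases Nat.eq_zero_or_pos (k + i) with h0 | h0
      · have : (γ (k + i)).1 = (γ k).1 := by
          rw [show k + i = k by omega]
        simp only [this]
        omega
      · have := h.pos (k + i) h0 (by omega)
        simp only
        push_cast at hkT
        omega
    · funext i
      split_ifs with hi
      · simp [hi]
      · simp [show k + (i - k) = i by omega]
  have hsub : ∀ n, halfWalks (T + 1) n ⊆ P n ∪ halfWalks T n := by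
    intro n γ h
    by_cases hi : ∃ i ≤ n, (γ i).1 = (T + 1 : ℕ)
    · exact Or.inl ⟨h, hi⟩
    · refine Or.inr ⟨h.1, fun i hi' => ?_⟩
      have h1 := h.2 i hi'
      have h2 : (γ i).1 ≠ (T + 1 : ℕ) := fun e => hi ⟨i, hi', e⟩
      push_cast at h1 h2
      omega
  calc _ ≤ genFun (fun n => P n ∪ halfWalks T n) z := genFun_mono hsub z
    _ ≤ genFun P z + genFun (halfWalks T) z := genFun_union_le _ _ _
    _ ≤ genFun (bridgesOfSpan (T + 1)) z * genFun (halfWalks T) z + genFun (halfWalks T) z := by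
        gcongr
        simpa using hP
    _ = _ := by ring

theorem genFun_halfWalks_zero_le (z : ℝ≥0∞) : genFun (halfWalks 0) z ≤ 1 := by
  have key : ∀ p : Σ n, halfWalks 0 n, p.1 = 0 ∧ (p.2 : ℕ → ℤ × ℤ) = fun _ => 0 := by
    rintro ⟨n, γ, h, hT⟩
    have hn : n = 0 := by
      by_contra hn
      have h1 := h.pos n (by omega) le_rfl
      have h2 := hT n le_rfl
      simp at h2
      omega
    subst hn
    refine ⟨rfl, funext fun i => ?_⟩
    simp only [h.const i (Nat.zero_le i), h.zero]
  have : Subsingleton (Σ n, halfWalks 0 n) := by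
    constructor
    rintro ⟨n, γ⟩ ⟨n', γ'⟩
    obtain ⟨h1, h2⟩ := key ⟨n, γ⟩
    obtain ⟨h3, h4⟩ := key ⟨n', γ'⟩
    simp only at h1 h2 h3 h4
    subst h1 h3
    congr 1
    exact Subtype.ext (h2.trans h4.symm)
  rcases isEmpty_or_nonempty (Σ n, halfWalks 0 n) with he | ⟨⟨p⟩⟩
  · simp [genFun]
  · rw [genFun, tsum_eq_single p fun q hq => absurd (Subsingleton.elim q p) hq, (key p).1, pow_zero]

/-- Iterating the recursion gives a product of factors 1 + B_t, and 1 + x ≤ exp x bounds it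
uniformly in `T`. -/
theorem genFun_halfWalks_le (T : ℕ) {z : ℝ≥0∞}
    (hz : ∑' T, genFun (bridgesOfSpan T) z ≠ ∞) :
    genFun (halfWalks T) z ≤
      ENNReal.ofReal (Real.exp (∑' T, genFun (bridgesOfSpan T) z).toReal) := by
  have hfin : ∀ t, genFun (bridgesOfSpan t) z ≠ ∞ := ENNReal.ne_top_of_tsum_ne_top hz
  have step : ∀ T, genFun (halfWalks T) z ≤
      ENNReal.ofReal (Real.exp (∑ t ∈ Finset.range (T + 1), (genFun (bridgesOfSpan t) z).toReal)) := by
    intro T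
    induction T with
    | zero =>
      refine (genFun_halfWalks_zero_le z).trans ?_
      rw [← ENNReal.ofReal_one]
      exact ENNReal.ofReal_le_ofReal (Real.one_le_exp (Finset.sum_nonneg fun _ _ => by positivity))
    | succ T ih =>
      refine (genFun_halfWalks_succ_le T z).trans ?_
      rw [Finset.sum_range_succ, Real.exp_add, mul_comm (Real.exp _),
        ENNReal.ofReal_mul (Real.exp_pos _).le]
      refine mul_le_mul' ?_ ih
      rw [← ENNReal.ofReal_toReal (hfin (T + 1)), ← ENNReal.ofReal_one,
        ← ENNReal.ofReal_add zero_le_one ENNReal.toReal_nonneg,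
        ENNReal.toReal_ofReal ENNReal.toReal_nonneg, add_comm]
      exact ENNReal.ofReal_le_ofReal (Real.add_one_le_exp _)
  refine (step T).trans (ENNReal.ofReal_le_ofReal (Real.exp_le_exp.2 ?_))
  rw [← ENNReal.toReal_sum fun t _ => hfin t]
  exact ENNReal.toReal_mono hz (ENNReal.sum_le_tsum _)

theorem tsum_genFun_bridgesOfSpan_le (z : ℝ≥0∞) :
    ∑' T, genFun (bridgesOfSpan T) z ≤ genFun (fun n => {γ | IsBridge n γ}) z := by
  let f : (Σ T, Σ n, bridgesOfSpan T n) → Σ n, {γ | IsBridge n γ} :=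
    fun p => ⟨p.2.1, p.2.2.1, p.2.2.2.1⟩
  have hf : Function.Injective f := by
    rintro ⟨T, n, γ, h, hT⟩ ⟨T', n', γ', h', hT'⟩ e
    simp only [f, Sigma.mk.injEq] at e
    obtain ⟨rfl, e⟩ := e
    simp only [heq_eq_eq, Subtype.mk.injEq] at e
    subst e
    have : T = T' := by exact_mod_cast hT.symm.trans hT'
    subst this
    rfl
  calc _ = ∑' p : Σ T, Σ n, bridgesOfSpan T n, z ^ (f p).1 := by
        rw [ENNReal.tsum_sigma']
        rfl
    _ ≤ _ := ENNReal.tsum_comp_le_tsum_of_injective hf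
        fun q : Σ n, {γ | IsBridge n γ} => z ^ q.1

/-- A walk of length below N has span at most N, so each partial sum over lengths is covered by the
bound on `halfWalks N`, which does not depend on N. -/
theorem genFun_isHalfWalk_ne_top {z : ℝ≥0∞}
    (hz : genFun (fun n => {γ | IsBridge n γ}) z ≠ ∞) :
    genFun (fun n => {γ | IsHalfWalk n γ}) z ≠ ∞ := by
  have hz' : ∑' T, genFun (bridgesOfSpan T) z ≠ ∞ :=
    ne_top_of_le_ne_top hz (tsum_genFun_bridgesOfSpan_le z)
  refine ne_top_of_le_ne_top ENNReal.ofReal_ne_top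
    (b := ENNReal.ofReal (Real.exp (∑' T, genFun (bridgesOfSpan T) z).toReal)) ?_
  rw [genFun, ENNReal.tsum_sigma']
  refine ENNReal.tsum_le_of_sum_range_le fun N => ?_
  refine le_trans ?_ (genFun_halfWalks_le N hz')
  rw [genFun, ENNReal.tsum_sigma']
  refine le_trans (Finset.sum_le_sum fun n hn => ?_) (ENNReal.sum_le_tsum (Finset.range N))
  refine ENNReal.tsum_mono_subtype (fun _ => z ^ n) fun γ h => ⟨h, fun i hi => ?_⟩
  have h1 := (h.toIsWalk.abs_le 0 i (by omega)).1
  rw [zero_add, h.zero, _root_.abs_le] at h1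
  have := Finset.mem_range.1 hn
  simp at h1
  omega

/-! ### Divergence of the bridge generating function at 1/μ. -/

/-- By Fekete's lemma the limit of a subadditive sequence divided by n is also its infimum. -/
theorem connectiveConstant_pow_le (n : ℕ) : connectiveConstant ^ n ≤ ((SAW n).ncard : ℝ) := by
  have hpos : ∀ n, (0 : ℝ) < (SAW n).ncard := fun n => by exact_mod_cast SAW_ncard_pos n
  have hsub : Subadditive fun n : ℕ => Real.log (SAW n).ncard := by
    intro m n
    rw [← Real.log_mul (hpos m).ne' (hpos n).ne']
    exact Real.log_le_log (hpos _) (by exact_mod_cast SAW_ncard_add_le m n)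
  have hbdd : BddBelow (Set.range fun n : ℕ => Real.log (SAW n).ncard / n) := ⟨0, by
    rintro _ ⟨n, rfl⟩
    exact div_nonneg (Real.log_nonneg (by exact_mod_cast SAW_ncard_pos n)) (Nat.cast_nonneg n)⟩
  have hlim : connectiveConstant = Real.exp hsub.lim := by
    refine tendsto_nhds_unique tendsto_connectiveConstant
      (((Real.continuous_exp.tendsto _).comp (hsub.tendsto_lim hbdd)).congr fun n => ?_)
    rw [Function.comp_apply, Real.rpow_def_of_pos (hpos n), mul_one_div]
  rcases eq_or_ne n 0 with rfl | hn
  · simpa using Nat.succ_le_of_lt (SAW_ncard_pos 0)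
  · have h := hsub.lim_le_div hbdd hn
    rw [le_div_iff₀ (by positivity)] at h
    rw [hlim, ← Real.exp_nat_mul, mul_comm, ← Real.exp_log (hpos n)]
    exact Real.exp_le_exp.2 h

theorem one_le_connectiveConstant : 1 ≤ connectiveConstant := by
  refine ge_of_tendsto' tendsto_connectiveConstant fun n => ?_
  exact Real.one_le_rpow (by exact_mod_cast SAW_ncard_pos n) (by positivity)

/-- Every term of the walk series at 1/μ is at least 1, so that series diverges. Finiteness for
bridges would pass to half-plane walks and then, through the product bound, to all walks. -/
theorem genFun_isBridge_eq_top :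
    genFun (fun n => {γ | IsBridge n γ}) (ENNReal.ofReal connectiveConstant⁻¹) = ∞ := by
  have hμ : 0 < connectiveConstant := zero_lt_one.trans_le one_le_connectiveConstant
  by_contra hB
  have hH := genFun_isHalfWalk_ne_top hB
  have hle := genFun_walks_le (ENNReal.ofReal connectiveConstant⁻¹)
  have htop : genFun (fun n => {γ | IsWalk n γ}) (ENNReal.ofReal connectiveConstant⁻¹) = ∞ := by
    rw [genFun_eq_tsum_ncard setOf_isWalk_finite, eq_top_iff]
    calc (∞ : ℝ≥0∞) = ∑' _ : ℕ, 1 := by simp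
      _ ≤ _ := ENNReal.tsum_le_tsum fun n => by
        rw [← ENNReal.ofReal_natCast, ← ENNReal.ofReal_pow (inv_nonneg.2 hμ.le),
          ← ENNReal.ofReal_mul (Nat.cast_nonneg _), ← ENNReal.ofReal_one]
        refine ENNReal.ofReal_le_ofReal ?_
        rw [inv_pow, ← div_eq_mul_inv, one_le_div (pow_pos hμ n)]
        exact (connectiveConstant_pow_le n).trans (by exact_mod_cast ncard_SAW_le n)
  rw [htop, pow_one, ENNReal.mul_top (by simpa using hμ)] at hle
  exact ENNReal.mul_ne_top hH hH (top_le_iff.1 hle)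

/-- Bridges are infinitely often nearly as numerous as the connective constant allows. -/
theorem frequently_le_ncard_isBridge {s : ℝ} (hs : 1 < s) :
    ∃ᶠ n : ℕ in atTop, (n : ℝ) ^ (-s) * connectiveConstant ^ n ≤ ({γ | IsBridge n γ}.ncard : ℝ) := by
  have hμ : 0 < connectiveConstant := zero_lt_one.trans_le one_le_connectiveConstant
  intro hev
  -- If the bound failed for all large n, the bridge series at 1/μ would be dominated by ∑ n^(-s).
  have hsum : Summable fun n : ℕ => ({γ | IsBridge n γ}.ncard : ℝ) * connectiveConstant⁻¹ ^ n := by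
    refine Summable.of_norm_bounded_eventually_nat
      (g := fun n : ℕ => (n : ℝ) ^ (-s)) (Real.summable_nat_rpow.2 (by linarith)) ?_
    filter_upwards [hev] with n hn
    rw [Real.norm_of_nonneg (by positivity), inv_pow, ← div_eq_mul_inv, div_le_iff₀ (pow_pos hμ n)]
    exact (not_le.1 hn).le
  have htop := genFun_isBridge_eq_top
  rw [genFun_eq_tsum_ncard setOf_isBridge_finite] at htop
  refine hsum.tsum_ofReal_ne_top ?_
  rw [← htop]
  refine tsum_congr fun n => ?_
  rw [ENNReal.ofReal_mul (Nat.cast_nonneg _), ENNReal.ofReal_natCast,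
    ENNReal.ofReal_pow (inv_nonneg.2 hμ.le)]

/-! ### Joining two bridges at mirror-image endpoints -/

/-- The walk `a`, a horizontal edge, and the mirror image of `b` traversed backwards. -/
def mirrorJoin (n : ℕ) (a b : ℕ → ℤ × ℤ) (i : ℕ) : ℤ × ℤ :=
  if i ≤ n then a i else (2 * (a n).1 + 1 - (b (2 * n + 1 - i)).1, (b (2 * n + 1 - i)).2)

theorem mirrorJoin_left {n i : ℕ} (a b : ℕ → ℤ × ℤ) (hi : i ≤ n) : mirrorJoin n a b i = a i :=
  if_pos hi

theorem mirrorJoin_right {n i : ℕ} (a b : ℕ → ℤ × ℤ) (hi : n < i) :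
    mirrorJoin n a b i = (2 * (a n).1 + 1 - (b (2 * n + 1 - i)).1, (b (2 * n + 1 - i)).2) :=
  if_neg hi.not_ge

theorem IsBridge.fst_nonneg {n : ℕ} {γ : ℕ → ℤ × ℤ} (h : IsBridge n γ) {i : ℕ} (hi : i ≤ n) :
    0 ≤ (γ i).1 := by
  rcases Nat.eq_zero_or_pos i with rfl | h0
  · simp [h.zero]
  · exact (h.pos i h0 hi).le

theorem mirrorJoin_last {n : ℕ} {a b : ℕ → ℤ × ℤ} (hb : IsBridge n b) :
    mirrorJoin n a b (2 * n + 1) = (2 * (a n).1 + 1, 0) := by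
  rw [mirrorJoin_right _ _ (by omega), Nat.sub_self, hb.zero]
  simp

/-- With X the common span, `a` occupies columns up to X and the mirrored `b` columns from X + 1 on,
so they are disjoint. The common endpoint makes the connecting edge horizontal. -/
theorem IsBridge.mirrorJoin {n : ℕ} {a b : ℕ → ℤ × ℤ} (ha : IsBridge n a) (hb : IsBridge n b)
    (hab : a n = b n) : IsBridge (2 * n + 1) (mirrorJoin n a b) := by
  have hX : 0 ≤ (a n).1 := ha.fst_nonneg le_rfl
  have hb' : ∀ i ≤ n, (b i).1 ≤ (a n).1 := fun i hi => hab ▸ hb.le_last i hi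
  refine ⟨⟨⟨?_, fun i hi => ?_, fun i j hi hj e => ?_, fun i hi => ?_⟩, fun i h0 hi => ?_⟩,
    fun i hi => ?_⟩
  · rw [mirrorJoin_left _ _ (Nat.zero_le n), ha.zero]
  · rcases lt_trichotomy i n with h | rfl | h
    · rw [mirrorJoin_left _ _ h.le, mirrorJoin_left _ _ h]
      exact ha.adj i h
    · rw [mirrorJoin_left _ _ le_rfl, mirrorJoin_right _ _ (Nat.lt_succ_self i),
        show 2 * i + 1 - (i + 1) = i by omega, ← hab]
      simp only [Adj]
      ring
    · rw [mirrorJoin_right _ _ h, mirrorJoin_right _ _ (by omega)]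
      have := hb.adj (2 * n + 1 - (i + 1)) (by omega)
      rw [show 2 * n + 1 - (i + 1) + 1 = 2 * n + 1 - i by omega] at this
      simp only [Adj] at this ⊢
      linarith
  · wlog hij : i ≤ j generalizing i j
    · exact (this j i hj hi e.symm (by omega)).symm
    rcases le_or_gt j n with h | h
    · rw [mirrorJoin_left _ _ h, mirrorJoin_left _ _ (hij.trans h)] at e
      exact ha.inj i j (by omega) h e
    rw [mirrorJoin_right _ _ h] at e
    rcases le_or_gt i n with h' | h'
    · rw [mirrorJoin_left _ _ h'] at e
      have h1 := congrArg Prod.fst e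
      have h2 := hb' (2 * n + 1 - j) (by omega)
      have h3 := ha.le_last i h'
      simp only at h1
      omega
    · rw [mirrorJoin_right _ _ h', Prod.mk.injEq] at e
      have := hb.inj _ _ (by omega) (by omega)
        (Prod.ext (by omega) e.2 : b (2 * n + 1 - i) = b (2 * n + 1 - j))
      omega
  · rw [mirrorJoin_right _ _ (by omega), mirrorJoin_right _ _ (by omega),
      show 2 * n + 1 - i = 0 by omega, Nat.sub_self]
  · rcases le_or_gt i n with h | h
    · rw [mirrorJoin_left _ _ h]
      exact ha.pos i h0 h
    · rw [mirrorJoin_right _ _ h]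
      have := hb' (2 * n + 1 - i) (by omega)
      simp only
      omega
  · rw [mirrorJoin_last hb]
    rcases le_or_gt i n with h | h
    · rw [mirrorJoin_left _ _ h]
      have := ha.le_last i h
      simp only
      omega
    · rw [mirrorJoin_right _ _ h]
      have := hb.fst_nonneg (i := 2 * n + 1 - i) (by omega)
      simp only
      omega

/-! ### Cyclic shifts of bridges -/

/-- The walk of length `N` obtained by following `V` from time `j` to time `N`, and then a translate
of `V` from time `0` to time `j`. -/
def cyclicShift (N j : ℕ) (V : ℕ → ℤ × ℤ) (i : ℕ) : ℤ × ℤ :=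
  -- The `min` freezes the walk from time `N` on, as `IsWalk.const` requires.
  if j + i ≤ N then V (j + i) - V j else V (min (j + i - N) j) + V N - V j

theorem cyclicShift_left {N j i : ℕ} (V : ℕ → ℤ × ℤ) (hi : j + i ≤ N) :
    cyclicShift N j V i = V (j + i) - V j := if_pos hi

theorem cyclicShift_right {N j i : ℕ} (V : ℕ → ℤ × ℤ) (hi : N < j + i) (hiN : i ≤ N) :
    cyclicShift N j V i = V (j + i - N) + V N - V j := by
  rw [cyclicShift, if_neg hi.not_ge, min_eq_left (by omega)]

theorem cyclicShift_last {N j : ℕ} {V : ℕ → ℤ × ℤ} (hV : V 0 = 0) :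
    cyclicShift N j V N = V N := by
  rcases Nat.eq_zero_or_pos j with rfl | h
  · rw [cyclicShift_left _ (by omega), hV]
    simp
  · rw [cyclicShift_right _ (by omega) le_rfl, Nat.add_sub_cancel]
    abel

/-- After its starting point, the copy of a bridge translated by its own displacement lies strictly
to the right of the original, so the concatenation avoids itself. -/
theorem IsBridge.cyclicShift {N j : ℕ} {V : ℕ → ℤ × ℤ} (h : IsBridge N V) (hj : j ≤ N) :
    IsWalk N (cyclicShift N j V) := by
  refine ⟨?_, fun i hi => ?_, fun i i' hi hi' e => ?_, fun i hi => ?_⟩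
  · rw [cyclicShift_left _ (by omega)]
    simp
  · rcases lt_trichotomy (j + i) N with h1 | h1 | h1
    · rw [cyclicShift_left _ h1.le, cyclicShift_left _ (by omega)]
      simpa [Adj, add_assoc] using h.adj (j + i) h1
    · rw [cyclicShift_left _ h1.le, cyclicShift_right _ (by omega) (by omega),
        show j + (i + 1) - N = 0 + 1 by omega, h1]
      have := h.adj 0 (by omega)
      simpa [Adj, h.zero, add_sub_right_comm] using this
    · rw [cyclicShift_right _ h1 hi.le, cyclicShift_right _ (by omega) (by omega),
        show j + (i + 1) - N = j + i - N + 1 by omega]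
      simpa [Adj] using h.adj (j + i - N) (by omega)
  · wlog hii : i ≤ i' generalizing i i'
    · exact (this i' i hi' hi e.symm (by omega)).symm
    rcases le_or_gt (j + i') N with h1 | h1
    · rw [cyclicShift_left _ h1, cyclicShift_left _ (by omega)] at e
      have := h.inj _ _ (by omega) h1 (sub_left_injective e)
      omega
    rw [cyclicShift_right _ h1 hi'] at e
    rcases le_or_gt (j + i) N with h2 | h2
    · rw [cyclicShift_left _ h2] at e
      have h3 := congrArg Prod.fst e
      have h4 := h.le_last (j + i) h2
      have h5 := h.pos (j + i' - N) (by omega) (by omega)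
      simp only [Prod.fst_sub, Prod.fst_add] at h3
      omega
    · rw [cyclicShift_right _ h2 hi] at e
      have := h.inj _ _ (by omega) (by omega) (add_right_cancel (sub_left_injective e))
      omega
  · rw [cyclicShift_last h.zero, SquareLattice.cyclicShift]
    split_ifs with h1
    · have : j = 0 := by omega
      subst this
      rw [h.zero, sub_zero, zero_add, h.const i hi]
    · rw [min_eq_right (by omega)]
      abel

/-- The final point of the shift is `V N`, and its value at time `N - j` is `V N - V j`. Both
translation vectors are therefore known, and the two pieces can be put back in order. -/
theorem cyclicShift_injective {N j : ℕ} {V V' : ℕ → ℤ × ℤ} (h : IsBridge N V) (h' : IsBridge N V')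
    (hj : j ≤ N) (e : cyclicShift N j V = cyclicShift N j V') : V = V' := by
  have hlast : V N = V' N := by
    rw [← cyclicShift_last (j := j) h.zero, e, cyclicShift_last h'.zero]
  have hVj : V j = V' j := by
    have h1 := congrFun e (N - j)
    rw [cyclicShift_left _ (by omega), cyclicShift_left _ (by omega), Nat.add_sub_cancel' hj,
      hlast] at h1
    exact sub_right_injective h1
  have key : ∀ i ≤ N, V i = V' i := by
    intro i hi
    rcases le_or_gt j i with h1 | h1
    · have h2 := congrFun e (i - j)
      rw [cyclicShift_left _ (by omega), cyclicShift_left _ (by omega), Nat.add_sub_cancel' h1,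
        hVj] at h2
      exact sub_left_injective h2
    · rcases Nat.eq_zero_or_pos i with rfl | h0
      · rw [h.zero, h'.zero]
      · have h2 := congrFun e (i + N - j)
        rw [cyclicShift_right _ (by omega) (by omega), cyclicShift_right _ (by omega) (by omega),
          hVj, hlast, show j + (i + N - j) - N = i by omega] at h2
        exact add_right_cancel (sub_left_injective h2)
  funext i
  rcases le_total i N with hi | hi
  · exact key i hi
  · rw [h.const i hi, h'.const i hi, hlast]

/-! ### Arcs in the upper half-plane -/

/-- A walk of length `N` in the upper half-plane from the origin to `(D, 0)`, of height at most
`2 * B`, with horizontal coordinates between `-D` and `2 * D`, and which reaches height `t` above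
the segment from the origin to `(D, 0)`. -/
structure IsArc (N : ℕ) (D B t : ℤ) (U : ℕ → ℤ × ℤ) : Prop extends IsWalk N U where
  last : U N = (D, 0)
  snd_nonneg : ∀ i ≤ N, 0 ≤ (U i).2
  snd_le : ∀ i ≤ N, (U i).2 ≤ 2 * B
  le_fst : ∀ i ≤ N, -D ≤ (U i).1
  fst_le : ∀ i ≤ N, (U i).1 ≤ 2 * D
  top : ∃ i ≤ N, 0 ≤ (U i).1 ∧ (U i).1 ≤ D ∧ t ≤ (U i).2

/-- The bridges of length `n` and span `X` whose vertical coordinates are bounded by `B` and have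
oscillation at least `t`. -/
def bridgeClass (n : ℕ) (X B t : ℤ) : Set (ℕ → ℤ × ℤ) :=
  {γ | IsBridge n γ ∧ (γ n).1 = X ∧ (∀ i ≤ n, |(γ i).2| ≤ B) ∧
    ∃ i ≤ n, ∃ j ≤ n, t ≤ (γ i).2 - (γ j).2}

/-- Shift to a time `j` of minimal height. Since the joined bridge ends at height zero, the
translated piece is not raised, so the whole shift stays above its start and ends level with it. -/
theorem exists_isArc_cyclicShift {n : ℕ} {X B t : ℤ} {a b : ℕ → ℤ × ℤ}
    (ha : a ∈ bridgeClass n X B t) (hb : b ∈ bridgeClass n X B t) (hab : a n = b n) :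
    ∃ j ≤ 2 * n + 1,
      IsArc (2 * n + 1) (2 * X + 1) B t (cyclicShift (2 * n + 1) j (mirrorJoin n a b)) := by
  obtain ⟨ha, hX, haB, i₁, hi₁, j₁, hj₁, hat⟩ := ha
  obtain ⟨hb, -, hbB, i₂, hi₂, j₂, hj₂, hbt⟩ := hb
  have hV := ha.mirrorJoin hb hab
  have hlast := mirrorJoin_last (a := a) hb
  rw [hX] at hlast
  set N := 2 * n + 1 with hN
  set V := mirrorJoin n a b with hVdef
  obtain ⟨j, hj, hmin, -⟩ := exists_last_min (fun i => (V i).2) N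
  have hx0 : ∀ i ≤ N, 0 ≤ (V i).1 := fun i hi => hV.fst_nonneg hi
  have hxD : ∀ i ≤ N, (V i).1 ≤ 2 * X + 1 := fun i hi => by simpa [hlast] using hV.le_last i hi
  have hyB : ∀ i ≤ N, |(V i).2| ≤ B := by
    intro i hi
    rcases le_or_gt i n with h | h
    · rw [hVdef, mirrorJoin_left _ _ h]
      exact haB i h
    · rw [hVdef, mirrorJoin_right _ _ h]
      exact hbB _ (by omega)
  simp only [abs_le] at hyB
  have hcases : ∀ i ≤ N, ∃ k ≤ N,
      (cyclicShift N j V i = V k - V j ∨ cyclicShift N j V i = V k + V N - V j) := by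
    intro i hi
    rcases le_or_gt (j + i) N with h | h
    · exact ⟨_, h, Or.inl (cyclicShift_left _ h)⟩
    · exact ⟨_, by omega, Or.inr (cyclicShift_right _ h hi)⟩
  have hjB := hyB j hj
  have hj0 := hx0 j hj
  have hjD := hxD j hj
  refine ⟨j, hj, hV.cyclicShift hj, by rw [cyclicShift_last hV.zero, hlast], fun i hi => ?_,
    fun i hi => ?_, fun i hi => ?_, fun i hi => ?_, ?_⟩
  · obtain ⟨k, hk, e | e⟩ := hcases i hi <;> rw [e] <;> have := hmin k hk <;> simp [hlast] <;> omega
  · obtain ⟨k, hk, e | e⟩ := hcases i hi <;> rw [e] <;> have := hyB k hk <;> simp [hlast] <;> omega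
  · obtain ⟨k, hk, e | e⟩ := hcases i hi <;> rw [e] <;> have := hx0 k hk <;> simp [hlast] <;> omega
  · obtain ⟨k, hk, e | e⟩ := hcases i hi <;> rw [e] <;> have := hxD k hk <;> simp [hlast] <;> omega
  -- The high point over the segment is taken from the half that does not contain the lowest point.
  -- If `j` is in the first half, use the mirrored `b`, which lies to its right; otherwise use the
  -- translated copy of `a`, which begins D further along.
  · rcases le_or_gt j n with h | h
    · have hk : n < N - i₂ := by omega
      have hVk : V (N - i₂) = (2 * X + 1 - (b i₂).1, (b i₂).2) := by
        rw [hVdef, mirrorJoin_right _ _ hk, ← hN, Nat.sub_sub_self (by omega), hX]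
      have hVk' : V (N - j₂) = (2 * X + 1 - (b j₂).1, (b j₂).2) := by
        rw [hVdef, mirrorJoin_right _ _ (by omega), ← hN, Nat.sub_sub_self (by omega), hX]
      refine ⟨N - i₂ - j, by omega, ?_⟩
      rw [cyclicShift_left _ (by omega), show j + (N - i₂ - j) = N - i₂ by omega]
      have h1 := hmin (N - j₂) (by omega)
      have h2 := hb.le_last i₂ hi₂
      rw [← hab, hX] at h2
      have h3 := ha.le_last j h
      rw [hX, ← mirrorJoin_left a b h, ← hVdef] at h3
      have h4 := hb.fst_nonneg hi₂
      rw [hVk'] at h1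
      simp only [hVk, Prod.fst_sub, Prod.snd_sub]
      simp only at h1
      omega
    · have hVk : V i₁ = a i₁ := mirrorJoin_left _ _ hi₁
      have hVk' : V j₁ = a j₁ := mirrorJoin_left _ _ hj₁
      have h1 := hmin j₁ (by omega)
      have h2 := ha.le_last i₁ hi₁
      have h4 := ha.fst_nonneg hi₁
      have h3 : X + 1 ≤ (V j).1 := by
        rw [hVdef, mirrorJoin_right _ _ h]
        have := hb.le_last (2 * n + 1 - j) (by omega)
        rw [← hab, hX] at this
        simp only [hX]
        omega
      rw [hVk'] at h1
      have key : cyclicShift N j V (i₁ + N - j) = V i₁ + V N - V j := by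
        -- For `i₁ = 0` the time falls on the junction, which belongs to the first branch of the
        -- shift.
        rcases Nat.eq_zero_or_pos i₁ with h0 | h0
        · rw [cyclicShift_left _ (by omega), show j + (i₁ + N - j) = N by omega, h0, hV.zero,
            zero_add]
        · rw [cyclicShift_right _ (by omega) (by omega), show j + (i₁ + N - j) - N = i₁ by omega]
      refine ⟨i₁ + N - j, by omega, ?_⟩
      rw [key, hVk, hlast]
      simp only [Prod.fst_sub, Prod.snd_sub, Prod.fst_add, Prod.snd_add]
      omega

theorem mirrorJoin_injective {n : ℕ} {a b a' b' : ℕ → ℤ × ℤ} (ha : IsWalk n a) (hb : IsWalk n b)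
    (ha' : IsWalk n a') (hb' : IsWalk n b') (e : mirrorJoin n a b = mirrorJoin n a' b') :
    a = a' ∧ b = b' := by
  have h1 : ∀ i ≤ n, a i = a' i := fun i hi => by
    have := congrFun e i
    rwa [mirrorJoin_left _ _ hi, mirrorJoin_left _ _ hi] at this
  have h2 : ∀ i ≤ n, b i = b' i := fun i hi => by
    have := congrFun e (2 * n + 1 - i)
    rw [mirrorJoin_right _ _ (by omega), mirrorJoin_right _ _ (by omega),
      Nat.sub_sub_self (by omega), h1 n le_rfl, Prod.mk.injEq] at this
    exact Prod.ext (by omega) this.2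
  constructor <;> funext i <;> rcases le_total i n with hi | hi
  · exact h1 i hi
  · rw [ha.const i hi, ha'.const i hi, h1 n le_rfl]
  · exact h2 i hi
  · rw [hb.const i hi, hb'.const i hi, h2 n le_rfl]

theorem bridgeClass_finite (n : ℕ) (X B t : ℤ) : (bridgeClass n X B t).Finite :=
  (setOf_isBridge_finite n).subset fun _ h => h.1

theorem setOf_isArc_finite (N : ℕ) (D B t : ℤ) : {U | IsArc N D B t U}.Finite :=
  (setOf_isWalk_finite N).subset fun _ h => h.toIsWalk

/-- This is Cauchy–Schwarz: the pairs with equal image are counted by the sum of the squares of the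
fibre sizes. -/
theorem sq_card_le_card_mul_card_filter {α β : Type*} [DecidableEq β] (s : Finset α) (t : Finset β)
    (f : α → β) (h : ∀ a ∈ s, f a ∈ t) :
    s.card ^ 2 ≤ t.card * ((s ×ˢ s).filter fun p => f p.1 = f p.2).card := by
  rw [Finset.card_eq_sum_card_fiberwise h]
  refine sq_sum_le_card_mul_sum_sq.trans (Nat.mul_le_mul_left _ ?_)
  rw [Finset.card_eq_sum_card_fiberwise (s := (s ×ˢ s).filter fun p => f p.1 = f p.2)
    (f := fun p => f p.1) (t := t) fun p hp => h _ (Finset.mem_product.1 (Finset.mem_filter.1 hp).1).1]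
  refine Finset.sum_le_sum fun e _ => ?_
  rw [sq, ← Finset.card_product]
  refine Finset.card_le_card fun p hp => ?_
  simp only [Finset.mem_product, Finset.mem_filter] at hp ⊢
  exact ⟨⟨⟨hp.1.1, hp.2.1⟩, hp.1.2.trans hp.2.2.symm⟩, hp.1.2⟩

/-- Endpoints in the class share a column and have 2u + 1 possible heights, which is the
Cauchy–Schwarz factor. A pair with a common endpoint is recovered from its arc and the shift time,
which has 2n + 2 possible values. -/
theorem sq_ncard_bridgeClass_le (n u : ℕ) (X t : ℤ) :
    (bridgeClass n X u t).ncard ^ 2 ≤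
      (2 * u + 1) * ((2 * n + 2) * {U | IsArc (2 * n + 1) (2 * X + 1) u t U}.ncard) := by
  classical
  have hfin := bridgeClass_finite n X u t
  set s := hfin.toFinset with hs
  have hms : ∀ {a}, a ∈ s → a ∈ bridgeClass n X u t := fun h => hfin.mem_toFinset.1 h
  have h1 := sq_card_le_card_mul_card_filter s (Finset.Icc (-(u : ℤ)) u) (fun a => (a n).2)
    fun a h => by simpa [abs_le] using (hms h).2.2.1 n le_rfl
  rw [Set.ncard_eq_toFinset_card _ hfin, ← hs]
  have hcard : (Finset.Icc (-(u : ℤ)) u).card = 2 * u + 1 := by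
    rw [Int.card_Icc]
    omega
  rw [hcard] at h1
  refine h1.trans (Nat.mul_le_mul_left _ ?_)
  set Q := (s ×ˢ s).filter fun p => (p.1 n).2 = (p.2 n).2 with hQ
  have hmem : ∀ p ∈ Q, p.1 ∈ bridgeClass n X u t ∧ p.2 ∈ bridgeClass n X u t ∧ p.1 n = p.2 n := by
    intro p hp
    rw [hQ, Finset.mem_filter, Finset.mem_product] at hp
    have h1 := hms hp.1.1
    have h2 := hms hp.1.2
    exact ⟨h1, h2, Prod.ext (h1.2.1.trans h2.2.1.symm) hp.2⟩
  have hex : ∀ p ∈ Q, ∃ j ≤ 2 * n + 1, IsArc (2 * n + 1) (2 * X + 1) u t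
      (cyclicShift (2 * n + 1) j (mirrorJoin n p.1 p.2)) := fun p hp =>
    exists_isArc_cyclicShift (hmem p hp).1 (hmem p hp).2.1 (hmem p hp).2.2
  choose! j hj harc using hex
  have hA := setOf_isArc_finite (2 * n + 1) (2 * X + 1) u t
  rw [Set.ncard_eq_toFinset_card _ hA, ← Finset.card_range (2 * n + 2), ← Finset.card_product]
  refine Finset.card_le_card_of_injOn
    (fun p => (j p, cyclicShift (2 * n + 1) (j p) (mirrorJoin n p.1 p.2))) ?_ ?_
  · intro p hp
    have h2 := hj p hp
    simp only [Finset.coe_product, Set.mem_prod, Finset.mem_coe, Finset.mem_range,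
      Set.Finite.mem_toFinset, Set.mem_ofPred_eq]
    exact ⟨by omega, harc p hp⟩
  · intro p hp q hq e
    simp only [Prod.mk.injEq] at e
    obtain ⟨e1, e2⟩ := e
    obtain ⟨hp1, hp2, hp3⟩ := hmem p hp
    obtain ⟨hq1, hq2, hq3⟩ := hmem q hq
    rw [← e1] at e2
    have h3 := cyclicShift_injective (hp1.1.mirrorJoin hp2.1 hp3) (hq1.1.mirrorJoin hq2.1 hq3)
      (hj p hp) e2
    have h4 := mirrorJoin_injective hp1.1.toIsWalk hp2.1.toIsWalk hq1.1.toIsWalk hq2.1.toIsWalk h3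
    exact Prod.ext h4.1 h4.2

/-! ### A popular class of bridges -/

/-- The scale is u = max(X, Y + 1), where Y is the vertical oscillation. If X < u then Y = u - 1, so
at every scale either the span or the oscillation is large. -/
theorem IsBridge.exists_mem_bridgeClass {n : ℕ} (hn : 0 < n) {γ : ℕ → ℤ × ℤ} (h : IsBridge n γ) :
    ∃ u X : ℕ, 1 ≤ u ∧ u ≤ n ∧ n ≤ u ^ 2 ∧ 1 ≤ X ∧ X ≤ u ∧
      γ ∈ bridgeClass n X u (if X < u then (u : ℤ) - 1 else 0) := by
  obtain ⟨j, hj, hjmin, -⟩ := exists_last_min (fun i => (γ i).2) n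
  obtain ⟨i, hi, himax, -⟩ := exists_last_min (fun i => -(γ i).2) n
  have hX0 := h.pos n hn le_rfl
  have hXn := (h.toIsWalk.abs_le 0 n (by omega)).1
  rw [zero_add, h.zero, abs_le, Prod.fst_zero, sub_zero] at hXn
  -- The first step of a bridge is horizontal, so only n - 1 steps can contribute to Y. This yields
  -- Y + 1 ≤ n, hence u ≤ n.
  have hy1 : (γ 1).2 = (γ 0).2 := by
    have h1 := h.adj 0 hn
    have h2 := h.pos 1 one_pos hn
    simp only [Adj, zero_add, h.zero] at h1 ⊢
    simp only [Prod.fst_zero, Prod.snd_zero, sub_zero] at h1 ⊢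
    nlinarith
  have hY : (γ i).2 - (γ j).2 ≤ n - 1 := by
    have hshift : ∀ k ≤ n, ∃ k', 1 ≤ k' ∧ k' ≤ n ∧ (γ k').2 = (γ k).2 := by
      intro k hk
      rcases Nat.eq_zero_or_pos k with rfl | h0
      · exact ⟨1, le_rfl, hn, hy1⟩
      · exact ⟨k, h0, hk, rfl⟩
    obtain ⟨i', hi1, hi2, hi3⟩ := hshift i hi
    obtain ⟨j', hj1, hj2, hj3⟩ := hshift j hj
    rcases le_total i' j' with hle | hle
    · have := (h.toIsWalk.abs_le i' (j' - i') (by omega)).2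
      rw [Nat.add_sub_cancel' hle, abs_le] at this
      omega
    · have := (h.toIsWalk.abs_le j' (i' - j') (by omega)).2
      rw [Nat.add_sub_cancel' hle, abs_le] at this
      omega
  have hy0 : (γ 0).2 = 0 := by simp [h.zero]
  have h1 := hjmin 0 (by omega)
  have h2 := himax 0 (by omega)
  rw [hy0] at h1 h2
  obtain ⟨X, hX⟩ := Int.eq_ofNat_of_zero_le hX0.le
  obtain ⟨Y, hY'⟩ := Int.eq_ofNat_of_zero_le (show 0 ≤ (γ i).2 - (γ j).2 by omega)
  -- The n distinct points visited after time 0 lie in X columns and Y + 1 rows.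
  have hbox : n ≤ X * (Y + 1) := by
    have hsub : Set.MapsTo γ (Finset.Icc 1 n : Finset ℕ)
        (Finset.Icc 1 (X : ℤ) ×ˢ Finset.Icc (γ j).2 (γ i).2 : Finset (ℤ × ℤ)) := by
      intro k hk
      simp only [Finset.coe_Icc, Set.mem_Icc] at hk
      have h3 := h.pos k (by omega) hk.2
      have h4 := h.le_last k hk.2
      have h5 := hjmin k hk.2
      have h6 := himax k hk.2
      simp only [Finset.coe_product, Finset.coe_Icc, Set.mem_prod, Set.mem_Icc]
      omega
    have hinj : Set.InjOn γ (Finset.Icc 1 n : Finset ℕ) := by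
      intro k hk k' hk' e
      simp only [Finset.coe_Icc, Set.mem_Icc] at hk hk'
      exact h.inj k k' hk.2 hk'.2 e
    have := Finset.card_le_card_of_injOn γ hsub hinj
    rw [Finset.card_product, Nat.card_Icc, Int.card_Icc, Int.card_Icc] at this
    rwa [show (n + 1 - 1) = n by omega, show ((X : ℤ) + 1 - 1).toNat = X by omega,
      show ((γ i).2 + 1 - (γ j).2).toNat = Y + 1 by omega] at this
  refine ⟨max X (Y + 1), X, by omega, by omega, hbox.trans ?_, by omega, by omega, h, hX,
    fun k hk => ?_, i, hi, j, hj, ?_⟩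
  · rw [sq]
    exact Nat.mul_le_mul (le_max_left _ _) (le_max_right _ _)
  · have h5 := hjmin k hk
    have h6 := himax k hk
    rw [abs_le]
    push_cast
    omega
  · split_ifs <;> push_cast <;> omega

/-- Pigeonhole with weight 1/(nu) on the class (u, X): each u carries u values of X, hence total
weight 1/n, and there are at most n values of u. The weighting keeps the loss at nu, which is much
less than n² when u is small. -/
theorem exists_ncard_bridgeClass_ge {n : ℕ} (hn : 0 < n) :
    ∃ u X : ℕ, 1 ≤ u ∧ u ≤ n ∧ n ≤ u ^ 2 ∧ 1 ≤ X ∧ X ≤ u ∧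
      {γ | IsBridge n γ}.ncard ≤
        n * u * (bridgeClass n X u (if X < u then (u : ℤ) - 1 else 0)).ncard := by
  classical
  let S : Finset (Σ _ : ℕ, ℕ) :=
    ((Finset.Icc 1 n).filter fun u => n ≤ u ^ 2).sigma fun u => Finset.Icc 1 u
  let C : (Σ _ : ℕ, ℕ) → Set (ℕ → ℤ × ℤ) := fun p =>
    bridgeClass n p.2 p.1 (if p.2 < p.1 then (p.1 : ℤ) - 1 else 0)
  have hmemS : ∀ u X : ℕ, (⟨u, X⟩ : Σ _ : ℕ, ℕ) ∈ S ↔ (1 ≤ u ∧ u ≤ n ∧ n ≤ u ^ 2) ∧ 1 ≤ X ∧ X ≤ u := by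
    simp [S, and_assoc]
  have hne : S.Nonempty := ⟨⟨n, 1⟩, (hmemS _ _).2 ⟨⟨hn, le_rfl, by nlinarith⟩, le_rfl, hn⟩⟩
  have hcover : ({γ | IsBridge n γ}.ncard : ℝ) ≤ ∑ p ∈ S, ((C p).ncard : ℝ) := by
    have hsub : {γ | IsBridge n γ} ⊆ ⋃ p ∈ S, C p := by
      intro γ h
      obtain ⟨u, X, h1, h2, h3, h4, h5, h6⟩ := IsBridge.exists_mem_bridgeClass hn h
      exact Set.mem_biUnion ((hmemS u X).2 ⟨⟨h1, h2, h3⟩, h4, h5⟩) h6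
    have hle := (Set.ncard_le_ncard hsub (S.finite_toSet.biUnion fun p _ =>
      bridgeClass_finite _ _ _ _)).trans (Finset.set_ncard_biUnion_le S C)
    exact_mod_cast hle
  have hsum : ∑ p ∈ S, ({γ | IsBridge n γ}.ncard : ℝ) / (n * p.1) ≤
      ∑ p ∈ S, ((C p).ncard : ℝ) := by
    refine le_trans ?_ hcover
    have hn' : (0 : ℝ) < n := by exact_mod_cast hn
    rw [Finset.sum_sigma]
    calc _ ≤ ∑ u ∈ (Finset.Icc 1 n).filter fun u => n ≤ u ^ 2,
          ({γ | IsBridge n γ}.ncard : ℝ) / n := by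
          refine Finset.sum_le_sum fun u hu => ?_
          have hu' : (0 : ℝ) < u := by
            have := (Finset.mem_Icc.1 (Finset.mem_filter.1 hu).1).1
            exact_mod_cast this
          simp only
          rw [Finset.sum_const, Nat.card_Icc, Nat.add_sub_cancel, nsmul_eq_mul]
          refine le_of_eq ?_
          field_simp
      _ ≤ ∑ u ∈ Finset.Icc 1 n, ({γ | IsBridge n γ}.ncard : ℝ) / n :=
          Finset.sum_le_sum_of_subset_of_nonneg (Finset.filter_subset _ _) fun _ _ _ => by positivity
      _ = _ := by
          rw [Finset.sum_const, Nat.card_Icc, Nat.add_sub_cancel, nsmul_eq_mul]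
          field_simp
  obtain ⟨⟨u, X⟩, hp, hle⟩ := Finset.exists_le_of_sum_le hne hsum
  obtain ⟨⟨h1, h2, h3⟩, h4, h5⟩ := (hmemS u X).1 hp
  refine ⟨u, X, h1, h2, h3, h4, h5, ?_⟩
  have hpos : (0 : ℝ) < n * u := by
    have : 0 < n * u := Nat.mul_pos hn h1
    exact_mod_cast this
  rw [div_le_iff₀' hpos, ← Nat.cast_mul, ← Nat.cast_mul] at hle
  exact Nat.cast_le.1 hle

/-! ### Line-width and height -/

theorem le_lineWidth {V : Set (ℤ × ℤ)} (hV : V.Finite) {a b y : ℤ} (ha : (a, y) ∈ V)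
    (hb : (b, y) ∈ V) : b - a ≤ lineWidth V := by
  have hfin : (Prod.fst '' V).Finite := hV.image _
  obtain ⟨hi, hhi⟩ := hfin.bddAbove
  obtain ⟨lo, hlo⟩ := hfin.bddBelow
  have hsub : ∀ y, Prod.fst '' (V ∩ hline y) ⊆ Prod.fst '' V :=
    fun y => Set.image_mono Set.inter_subset_left
  have hbdd : BddAbove {w | ∃ y : ℤ, (V ∩ hline y).Nonempty ∧
      w = xMax (V ∩ hline y) - xMin (V ∩ hline y)} := by
    refine ⟨hi - lo, ?_⟩
    rintro w ⟨y, hne, rfl⟩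
    exact sub_le_sub (csSup_le (hne.image _) fun x hx => hhi (hsub y hx))
      (le_csInf (hne.image _) fun x hx => hlo (hsub y hx))
  have ha' : a ∈ Prod.fst '' (V ∩ hline y) := ⟨(a, y), ⟨ha, rfl⟩, rfl⟩
  have hb' : b ∈ Prod.fst '' (V ∩ hline y) := ⟨(b, y), ⟨hb, rfl⟩, rfl⟩
  have hfin' := hfin.subset (hsub y)
  exact (sub_le_sub (le_csSup hfin'.bddAbove hb') (csInf_le hfin'.bddBelow ha')).trans
    (le_csSup hbdd ⟨y, ⟨_, ha, rfl⟩, rfl⟩)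

theorem height_le {V : Set (ℤ × ℤ)} (hne : V.Nonempty) {c d : ℤ}
    (h : ∀ z ∈ V, c ≤ z.2 ∧ z.2 ≤ d) : height V ≤ d - c := by
  refine sub_le_sub (csSup_le (hne.image _) ?_) (le_csInf (hne.image _) ?_) <;>
    rintro _ ⟨z, hz, rfl⟩
  · exact (h z hz).2
  · exact (h z hz).1

/-! ### Closed walks and their traces -/

theorem vertices_closedTrace {n : ℕ} (γ : Fin (n + 1) → ℤ × ℤ) :
    vertices (closedTrace γ) = Set.range γ := by
  ext z
  constructor
  · rintro ⟨e, (⟨i, rfl⟩ | rfl), hz⟩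
    · rcases Sym2.mem_iff.1 hz with rfl | rfl <;> exact ⟨_, rfl⟩
    · rcases Sym2.mem_iff.1 hz with rfl | rfl <;> exact ⟨_, rfl⟩
  · rintro ⟨i, rfl⟩
    refine Fin.lastCases ?_ (fun j => ?_) i
    · exact ⟨_, Or.inr rfl, Sym2.mem_mk_left _ _⟩
    · exact ⟨_, Or.inl ⟨j, rfl⟩, Sym2.mem_mk_left _ _⟩

/-- A closing walk is determined by its trace and its endpoints. -/
theorem eq_of_closedTrace_eq {n : ℕ} (hn : 1 < n) {γ γ' : Fin (n + 1) → ℤ × ℤ}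
    (h : Function.Injective γ) (h' : Function.Injective γ') (h0 : γ 0 = γ' 0)
    (hlast : γ (Fin.last n) = γ' (Fin.last n)) (e : closedTrace γ = closedTrace γ') : γ = γ' := by
  have key : ∀ k : ℕ, ∀ i : Fin (n + 1), (i : ℕ) ≤ k → γ i = γ' i := by
    intro k
    induction k with
    | zero =>
      intro i hi
      rw [show i = 0 from Fin.ext (by simpa using hi), h0]
    | succ k ih =>
      intro i hi
      rcases Nat.le_or_eq_of_le_succ hi with hi | hi
      · exact ih i hi
      have hkn : k < n := by omega
      have hi' : i = (⟨k, hkn⟩ : Fin n).succ := Fin.ext hi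
      have hk := ih (⟨k, hkn⟩ : Fin n).castSucc le_rfl
      have hmem : s(γ (⟨k, hkn⟩ : Fin n).castSucc, γ i) ∈ closedTrace γ' := by
        rw [← e, hi']
        exact Or.inl ⟨_, rfl⟩
      -- In the trace of `γ'` this edge could be the next one, the previous one, or the closing one.
      -- The previous one would make `γ` revisit a point. The closing one would force `k = 0` and `k
      -- + 1 = n`, which `1 < n` excludes.
      rcases hmem with ⟨j, hj⟩ | hj
      · rcases Sym2.eq_iff.1 hj with ⟨h1, h2⟩ | ⟨h1, h2⟩
        · have h3 := congrArg Fin.val (h' (h1.trans hk))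
          have h4 : j = ⟨k, hkn⟩ := Fin.ext (by simpa using h3)
          rw [← h2, h4, hi']
        · have h3 := congrArg Fin.val (h' (h2.trans hk))
          have h4 := ih j.castSucc (by simp at h3 ⊢; omega)
          have h5 := congrArg Fin.val (h (h4.trans h1))
          simp at h3 h5
          omega
      · rcases Sym2.eq_iff.1 hj with ⟨h1, -⟩ | ⟨h1, h2⟩
        · have h3 := congrArg Fin.val (h' (hk.symm.trans h1))
          simp at h3
          omega
        · have h3 := congrArg Fin.val (h' (hk.symm.trans h1))
          have h4 := congrArg Fin.val (h (h2.trans hlast.symm))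
          simp at h3 h4
          omega
  exact funext fun i => key i i le_rfl

/-- Fix one closed walk for each class of polygons. A trace through the origin is the translate that
brings one of its n + 1 vertices to the origin, so class and vertex determine the trace; the
prescribed endpoints then determine the walk. -/
theorem card_le_mul_ncard_WSAP {n u : ℕ} (hn : 1 < n) {c : ℤ × ℤ}
    (F : Finset (Fin (n + 1) → ℤ × ℤ)) (hsaw : ∀ γ ∈ F, IsSAW γ)
    (hclose : ∀ γ ∈ F, Adj (γ (Fin.last n)) (γ 0)) (h0 : ∀ γ ∈ F, γ 0 = 0)
    (hlast : ∀ γ ∈ F, γ (Fin.last n) = c)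
    (hwide : ∀ γ ∈ F, (u : ℤ) ≤ lineWidth (Set.range γ))
    (hheight : ∀ γ ∈ F, height (Set.range γ) ≤ 16 * (u : ℤ)) :
    F.card ≤ (n + 1) * (WSAP (n + 1) u).ncard := by
  classical
  have := SAP_finite (n + 1)
  have hW : (WSAP (n + 1) u).Finite := Set.toFinite _
  have hrep : ∀ p : SAP (n + 1), ∃ γ : Fin (n + 1) → ℤ × ℤ,
      ∃ h : IsPolygon (n + 1) (closedTrace γ), (⟦⟨closedTrace γ, h⟩⟧ : SAP (n + 1)) = p := by
    intro p
    induction p using Quotient.inductionOn with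
    | h P =>
      obtain ⟨P, hP⟩ := P
      obtain ⟨n', h1, h2, γ, h3, h4, rfl⟩ := id hP
      obtain rfl : n' = n := by omega
      exact ⟨γ, hP, rfl⟩
  choose rep hpoly hrep using hrep
  have hP : ∀ γ ∈ F, IsPolygon (n + 1) (closedTrace γ) :=
    fun γ hγ => ⟨n, hn, rfl, γ, hsaw γ hγ, hclose γ hγ, rfl⟩
  have hex : ∀ γ ∈ F, ∃ p ∈ WSAP (n + 1) u, ∃ k : Fin (n + 1),
      closedTrace γ = translate (-rep p k) (closedTrace (rep p)) := by
    intro γ hγ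
    refine ⟨⟦⟨closedTrace γ, hP γ hγ⟩⟧, ⟨?_, ?_⟩, ?_⟩
    · change (u : ℤ) ≤ lineWidth (vertices (closedTrace γ))
      rw [vertices_closedTrace]
      exact hwide γ hγ
    · change height (vertices (closedTrace γ)) ≤ 16 * (u : ℤ)
      rw [vertices_closedTrace]
      exact hheight γ hγ
    · obtain ⟨v, hv⟩ := Quotient.exact (hrep ⟦⟨closedTrace γ, hP γ hγ⟩⟧)
      simp only at hv
      have hmem : (0 : ℤ × ℤ) ∈ vertices (closedTrace γ) := by
        rw [vertices_closedTrace]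
        exact ⟨0, h0 γ hγ⟩
      rw [hv, vertices_translate, vertices_closedTrace] at hmem
      obtain ⟨_, ⟨k, rfl⟩, hk⟩ := hmem
      refine ⟨k, ?_⟩
      rw [← eq_neg_of_add_eq_zero_left hk]
      exact hv
  rcases F.eq_empty_or_nonempty with rfl | ⟨γ₀, hγ₀⟩
  · simp
  have : Nonempty (SAP (n + 1)) := ⟨⟦⟨_, hP γ₀ hγ₀⟩⟧⟩
  choose! p hp k hk using hex
  rw [Set.ncard_eq_toFinset_card _ hW]
  calc F.card ≤ ((Finset.univ : Finset (Fin (n + 1))) ×ˢ hW.toFinset).card := by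
        refine Finset.card_le_card_of_injOn (fun γ => (k γ, p γ)) (fun γ hγ => ?_)
          fun γ hγ γ' hγ' e => ?_
        · simpa using hp γ hγ
        · simp only [Prod.mk.injEq] at e
          refine eq_of_closedTrace_eq hn (hsaw γ hγ).2 (hsaw γ' hγ').2
            ((h0 γ hγ).trans (h0 γ' hγ').symm) ((hlast γ hγ).trans (hlast γ' hγ').symm) ?_
          rw [hk γ hγ, hk γ' hγ', e.1, e.2]
    _ = _ := by simp

/-! ### Gluing two arcs into a polygon -/

/-- The walk that follows `U₁` and then, backwards, the reflection of `U₂` in the line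
`y = -1 / 2`. -/
def glueArcs (N : ℕ) (U₁ U₂ : ℕ → ℤ × ℤ) (i : Fin (2 * N + 1 + 1)) : ℤ × ℤ :=
  if (i : ℕ) ≤ N then U₁ i else ((U₂ (2 * N + 1 - i)).1, -1 - (U₂ (2 * N + 1 - i)).2)

section glue

variable {N : ℕ} {D B t : ℤ} {U₁ U₂ : ℕ → ℤ × ℤ}

theorem glueArcs_left (U₁ U₂ : ℕ → ℤ × ℤ) {i : Fin (2 * N + 1 + 1)} (hi : (i : ℕ) ≤ N) :
    glueArcs N U₁ U₂ i = U₁ i := if_pos hi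

theorem glueArcs_right (U₁ U₂ : ℕ → ℤ × ℤ) {i : Fin (2 * N + 1 + 1)} (hi : N < (i : ℕ)) :
    glueArcs N U₁ U₂ i = ((U₂ (2 * N + 1 - i)).1, -1 - (U₂ (2 * N + 1 - i)).2) :=
  if_neg hi.not_ge

theorem mem_range_glueArcs_left (U₁ U₂ : ℕ → ℤ × ℤ) {i : ℕ} (hi : i ≤ N) :
    U₁ i ∈ Set.range (glueArcs N U₁ U₂) := ⟨⟨i, by omega⟩, glueArcs_left _ _ hi⟩

theorem mem_range_glueArcs_right (U₁ U₂ : ℕ → ℤ × ℤ) {i : ℕ} (hi : i ≤ N) :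
    ((U₂ i).1, -1 - (U₂ i).2) ∈ Set.range (glueArcs N U₁ U₂) := by
  refine ⟨⟨2 * N + 1 - i, by omega⟩, ?_⟩
  rw [glueArcs_right _ _ (by simp only; omega)]
  simp only [show 2 * N + 1 - (2 * N + 1 - i) = i by omega]

theorem glueArcs_zero (h₁ : IsArc N D B t U₁) : glueArcs N U₁ U₂ 0 = 0 := by
  rw [glueArcs_left _ _ (by simp)]
  exact h₁.zero

theorem glueArcs_last (h₂ : IsArc N D B t U₂) :
    glueArcs N U₁ U₂ (Fin.last (2 * N + 1)) = (0, -1) := by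
  rw [glueArcs_right _ _ (by simp only [Fin.val_last]; omega)]
  simp [h₂.zero]

/-- One arc has heights at least 0 and the reflected one heights at most -1, so they are disjoint
and their matching ends are joined by vertical edges. -/
theorem isSAW_glueArcs (h₁ : IsArc N D B t U₁) (h₂ : IsArc N D B t U₂) :
    IsSAW (glueArcs N U₁ U₂) := by
  constructor
  · intro i
    rcases lt_trichotomy (i : ℕ) N with h | h | h
    · rw [glueArcs_left _ _ (by simpa using h.le), glueArcs_left _ _ (by simpa using h)]
      exact h₁.adj i h
    · rw [glueArcs_left _ _ (by simpa using h.le), glueArcs_right _ _ (by simp [h])]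
      simp [Adj, h, show 2 * N + 1 - (N + 1) = N by omega, h₁.last, h₂.last]
    · rw [glueArcs_right _ _ (by simpa using h), glueArcs_right _ _ (by simp; omega)]
      have hi := i.2
      have := h₂.adj (2 * N + 1 - (i + 1)) (by omega)
      rw [show 2 * N + 1 - ((i : ℕ) + 1) + 1 = 2 * N + 1 - i by omega] at this
      simp only [Adj, Fin.val_castSucc, Fin.val_succ] at this ⊢
      linarith
  · intro i j e
    wlog hij : i ≤ j generalizing i j
    · exact (this e.symm (le_of_not_ge hij)).symm
    have hij' : (i : ℕ) ≤ j := hij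
    have hi2 := i.2
    have hj2 := j.2
    rcases le_or_gt (j : ℕ) N with h | h
    · rw [glueArcs_left _ _ h, glueArcs_left _ _ (hij'.trans h)] at e
      exact Fin.ext (h₁.inj _ _ (hij'.trans h) h e)
    rw [glueArcs_right _ _ h] at e
    rcases le_or_gt (i : ℕ) N with h' | h'
    · rw [glueArcs_left _ _ h'] at e
      have h3 := congrArg Prod.snd e
      have h4 := h₁.snd_nonneg i h'
      have h5 := h₂.snd_nonneg (2 * N + 1 - j) (by omega)
      simp only at h3
      omega
    · rw [glueArcs_right _ _ h', Prod.mk.injEq] at e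
      have := h₂.inj _ _ (by omega) (by omega)
        (Prod.ext e.1 (by omega) : U₂ (2 * N + 1 - i) = U₂ (2 * N + 1 - j))
      exact Fin.ext (by omega)

theorem glueArcs_injective {U₁' U₂' : ℕ → ℤ × ℤ} (h₁ : IsArc N D B t U₁) (h₂ : IsArc N D B t U₂)
    (h₁' : IsArc N D B t U₁') (h₂' : IsArc N D B t U₂')
    (e : glueArcs N U₁ U₂ = glueArcs N U₁' U₂') : U₁ = U₁' ∧ U₂ = U₂' := by
  constructor <;> funext i <;> rcases le_total i N with hi | hi
  · have := congrFun e ⟨i, by omega⟩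
    rwa [glueArcs_left _ _ hi, glueArcs_left _ _ hi] at this
  · rw [h₁.const i hi, h₁'.const i hi, h₁.last, h₁'.last]
  · have := congrFun e ⟨2 * N + 1 - i, by omega⟩
    rw [glueArcs_right _ _ (by simp only; omega), glueArcs_right _ _ (by simp only; omega)] at this
    simp only [show 2 * N + 1 - (2 * N + 1 - i) = i by omega, Prod.mk.injEq] at this
    exact Prod.ext this.1 (by omega)
  · rw [h₂.const i hi, h₂'.const i hi, h₂.last, h₂'.last]

theorem glueArcs_bounds (h₁ : IsArc N D B t U₁) (h₂ : IsArc N D B t U₂) {z : ℤ × ℤ}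
    (hz : z ∈ Set.range (glueArcs N U₁ U₂)) :
    (-D ≤ z.1 ∧ z.1 ≤ 2 * D) ∧ -1 - 2 * B ≤ z.2 ∧ z.2 ≤ 2 * B := by
  obtain ⟨i, rfl⟩ := hz
  have hB : 0 ≤ 2 * B := (h₁.snd_nonneg 0 (Nat.zero_le N)).trans (h₁.snd_le 0 (Nat.zero_le N))
  rcases le_or_gt (i : ℕ) N with h | h
  · rw [glueArcs_left _ _ h]
    have := h₁.snd_nonneg i h
    exact ⟨⟨h₁.le_fst i h, h₁.fst_le i h⟩, by omega, h₁.snd_le i h⟩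
  · rw [glueArcs_right _ _ h]
    have hk : 2 * N + 1 - (i : ℕ) ≤ N := by omega
    have h3 := h₂.snd_nonneg _ hk
    have h4 := h₂.snd_le _ hk
    exact ⟨⟨h₂.le_fst _ hk, h₂.fst_le _ hk⟩, by simp only; omega, by simp only; omega⟩

/-- A discrete intermediate value theorem, applied at the first time the arc reaches column `x` or
beyond. -/
theorem IsArc.exists_fst_eq (h : IsArc N D B t U₁) {x : ℤ} (h0 : 0 ≤ x) (hx : x ≤ D) :
    ∃ k ≤ N, (U₁ k).1 = x := by
  classical
  have hex : ∃ k, x ≤ (U₁ k).1 := ⟨N, by rw [h.last]; exact hx⟩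
  have hle : Nat.find hex ≤ N := Nat.find_min' hex (by rw [h.last]; exact hx)
  refine ⟨Nat.find hex, hle, le_antisymm ?_ (Nat.find_spec hex)⟩
  rcases Nat.eq_zero_or_pos (Nat.find hex) with hz | hpos
  · rw [hz, h.zero]
    exact h0
  · obtain ⟨k, hk⟩ := Nat.exists_eq_succ_of_ne_zero hpos.ne'
    have h1 := Nat.find_min hex (m := k) (by omega)
    have h2 := (abs_sub_le_of_adj (h.adj k (by omega))).1
    rw [hk, Nat.succ_eq_add_one]
    rw [abs_le] at h2
    omega

end glue

/-! ### Wide polygons from pairs of arcs, after exchanging coordinates if necessary. -/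

theorem isSAW_swap {n : ℕ} {γ : Fin (n + 1) → ℤ × ℤ} (h : IsSAW γ) :
    IsSAW fun i => (γ i).swap :=
  ⟨fun i => by simpa [Adj, add_comm] using h.1 i, fun _ _ e => h.2 (Prod.swap_injective e)⟩

theorem sq_ncard_isArc_le {N u X : ℕ} (hN : 0 < N) (hu : 1 ≤ u) (hX : X ≤ u) :
    {U | IsArc N (2 * X + 1) u (if X < u then (u : ℤ) - 1 else 0) U}.ncard ^ 2 ≤
      (2 * N + 2) * (WSAP (2 * N + 2) u).ncard := by
  classical
  set t : ℤ := if X < u then (u : ℤ) - 1 else 0 with ht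
  have hA := setOf_isArc_finite N (2 * X + 1) u t
  set s := hA.toFinset with hs
  have hms : ∀ {U}, U ∈ s → IsArc N (2 * X + 1) u t U := fun h => hA.mem_toFinset.1 h
  rw [Set.ncard_eq_toFinset_card _ hA, ← hs, sq, ← Finset.card_product]
  have hinj : Set.InjOn (fun p : (ℕ → ℤ × ℤ) × (ℕ → ℤ × ℤ) => glueArcs N p.1 p.2)
      (s ×ˢ s : Finset _) := by
    rintro ⟨U₁, U₂⟩ hU ⟨U₁', U₂'⟩ hU' e
    rw [Finset.mem_coe, Finset.mem_product] at hU hU'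
    have := glueArcs_injective (hms hU.1) (hms hU.2) (hms hU'.1) (hms hU'.2) e
    exact Prod.ext this.1 this.2
  rcases Nat.lt_or_ge X u with hlt | hge
  · rw [if_pos hlt] at ht
    rw [← Finset.card_image_of_injOn (f := fun p i => (glueArcs N p.1 p.2 i).swap)
      fun p hp q hq e => hinj hp hq (funext fun i => Prod.swap_injective (congrFun e i))]
    refine card_le_mul_ncard_WSAP (c := (-1, 0)) (by omega) _ ?_ ?_ ?_ ?_ ?_ ?_ <;>
      simp only [Finset.forall_mem_image, Prod.forall, Finset.mem_product, and_imp] <;>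
      intro U₁ U₂ h₁ h₂ <;> replace h₁ := hms h₁ <;> replace h₂ := hms h₂
    · exact isSAW_swap (isSAW_glueArcs h₁ h₂)
    · rw [glueArcs_zero h₁, glueArcs_last h₂]
      simp [Adj]
    · rw [glueArcs_zero h₁]
      rfl
    · rw [glueArcs_last h₂]
      rfl
    -- The reflected second arc meets the column of the first arc's high point at height at most -1.
    -- The gap is at least (u - 1) + 1 = u, and it becomes horizontal under the exchange.
    · obtain ⟨i, hi, hx0, hxD, hy⟩ := h₁.top
      obtain ⟨k, hk, hkx⟩ := h₂.exists_fst_eq hx0 hxD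
      obtain ⟨i', hi'⟩ := mem_range_glueArcs_left U₁ U₂ hi
      obtain ⟨k', hk'⟩ := mem_range_glueArcs_right U₁ U₂ hk
      refine le_trans ?_ (le_lineWidth (Set.finite_range _) (a := -1 - (U₂ k).2) (b := (U₁ i).2)
        (y := (U₁ i).1) ⟨k', ?_⟩ ⟨i', ?_⟩)
      · have := h₂.snd_nonneg k hk
        omega
      · simp only [hk', hkx, Prod.swap_prod_mk]
      · simp only [hi', Prod.swap]
    -- The new height is the old horizontal extent, at most 3(2X + 1) ≤ 6u - 3.
    · refine (height_le (Set.range_nonempty _) (c := -(2 * X + 1)) (d := 2 * (2 * X + 1)) ?_).trans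
        (by omega)
      rintro _ ⟨i, rfl⟩
      exact (glueArcs_bounds h₁ h₂ ⟨i, rfl⟩).1
  · rw [← Finset.card_image_of_injOn hinj]
    refine card_le_mul_ncard_WSAP (c := (0, -1)) (by omega) _ ?_ ?_ ?_ ?_ ?_ ?_ <;>
      simp only [Finset.forall_mem_image, Prod.forall, Finset.mem_product, and_imp] <;>
      intro U₁ U₂ h₁ h₂ <;> replace h₁ := hms h₁ <;> replace h₂ := hms h₂
    · exact isSAW_glueArcs h₁ h₂
    · rw [glueArcs_zero h₁, glueArcs_last h₂]
      simp [Adj]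
    · exact glueArcs_zero h₁
    · exact glueArcs_last h₂
    -- Here X = u, and the ends of the upper arc are 2u + 1 apart on one line.
    · have h3 := mem_range_glueArcs_left U₁ U₂ (Nat.zero_le N)
      have h4 := mem_range_glueArcs_left U₁ U₂ (le_refl N)
      rw [h₁.zero] at h3
      rw [h₁.last] at h4
      refine le_trans ?_ (le_lineWidth (Set.finite_range _) h3 h4)
      simp only [sub_zero]
      omega
    · refine (height_le (Set.range_nonempty _) (c := -1 - 2 * u) (d := 2 * u) ?_).trans (by omega)
      intro z hz
      exact (glueArcs_bounds h₁ h₂ hz).2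

/-! ### Collecting the polynomial losses. -/

/-- Wide polygons of length `4 * n + 4` are nearly as numerous as quadruples of bridges of
length `n`. -/
theorem exists_ncard_isBridge_pow_le {n : ℕ} (hn : 0 < n) :
    ∃ u : ℕ, 1 ≤ u ∧ u ≤ n ∧ n ≤ u ^ 2 ∧
      {γ | IsBridge n γ}.ncard ^ 4 ≤ 1152 * u ^ 20 * (WSAP (4 * n + 4) u).ncard := by
  obtain ⟨u, X, h1, h2, h3, -, h5, hb⟩ := exists_ncard_bridgeClass_ge hn
  refine ⟨u, h1, h2, h3, ?_⟩
  have hK := sq_ncard_bridgeClass_le n u X (if X < u then (u : ℤ) - 1 else 0)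
  have hR := sq_ncard_isArc_le (N := 2 * n + 1) (by omega) h1 h5
  rw [show 2 * (2 * n + 1) + 2 = 4 * n + 4 by ring] at hR
  generalize {γ | IsBridge n γ}.ncard = b at hb ⊢
  generalize (bridgeClass n X u (if X < u then (u : ℤ) - 1 else 0)).ncard = K at hb hK
  generalize {U | IsArc (2 * n + 1) (2 * X + 1) u (if X < u then (u : ℤ) - 1 else 0) U}.ncard = R
    at hK hR
  generalize (WSAP (4 * n + 4) u).ncard = W at hR ⊢
  -- The losses multiply to 1152 n^7 u^6, and n ≤ u² turns n^7 into u^14.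
  calc b ^ 4 ≤ (n * u * K) ^ 4 := Nat.pow_le_pow_left hb 4
    _ = (n * u) ^ 4 * (K ^ 2) ^ 2 := by ring
    _ ≤ (n * u) ^ 4 * ((2 * u + 1) * ((2 * n + 2) * R)) ^ 2 := by gcongr
    _ ≤ (n * u) ^ 4 * ((3 * u) * ((4 * n) * R)) ^ 2 := by gcongr <;> omega
    _ = 144 * n ^ 6 * u ^ 6 * R ^ 2 := by ring
    _ ≤ 144 * n ^ 6 * u ^ 6 * ((4 * n + 4) * W) := by gcongr
    _ ≤ 144 * n ^ 6 * u ^ 6 * ((8 * n) * W) := by gcongr; omega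
    _ = 1152 * n ^ 7 * u ^ 6 * W := by ring
    _ ≤ 1152 * (u ^ 2) ^ 7 * u ^ 6 * W := by gcongr
    _ = 1152 * u ^ 20 * W := by ring

/-- On infinitely many scales, wide polygons are as numerous as the connective constant predicts, up
to a polynomial factor. -/
theorem exists_infinite_le_ncard_WSAP (α : ℝ) (hα : 29 < α) :
    ∃ A : Set ℕ, A.Infinite ∧ ∀ u ∈ A, 0 < u ∧
      ∃ m ∈ Set.Icc (4 * u + 4) (4 * u ^ 2 + 4), Even m ∧
        (u : ℝ) ^ (-α) * connectiveConstant ^ m ≤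
          ((WSAP m u).ncard : ℝ) := by
  refine ⟨{u | 0 < u ∧ ∃ m ∈ Set.Icc (4 * u + 4) (4 * u ^ 2 + 4), Even m ∧
    (u : ℝ) ^ (-α) * connectiveConstant ^ m ≤ ((WSAP m u).ncard : ℝ)},
    Set.infinite_of_forall_exists_gt fun M => ?_, fun u hu => hu⟩
  have hμ : 0 < connectiveConstant := zero_lt_one.trans_le one_le_connectiveConstant
  -- Once u ≥ C, the factor u^(1/2) absorbs 1152 μ^4, where μ^4 comes from m = 4n + 4. With s =
  -- 17/16 the exponents add up to 8s + 20 + 1/2 = 29.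
  obtain ⟨C, hC⟩ := exists_nat_ge ((1152 * connectiveConstant ^ 4) ^ 2)
  obtain ⟨n, hnb, hn⟩ := ((frequently_le_ncard_isBridge (s := 17 / 16) (by norm_num)).and_eventually
    (eventually_gt_atTop ((M + C) ^ 2))).exists
  obtain ⟨u, hu, hun, hnu, hW⟩ := exists_ncard_isBridge_pow_le (n := n) (by omega)
  have hMu : M + C < u := lt_of_pow_lt_pow_left₀ 2 (Nat.zero_le u) (hn.trans_le hnu)
  refine ⟨u, ⟨hu, 4 * n + 4, ⟨by omega, by omega⟩, ⟨2 * n + 2, by ring⟩, ?_⟩, by omega⟩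
  have hu1 : (1 : ℝ) ≤ u := by exact_mod_cast hu
  have hu0 : (0 : ℝ) < u := zero_lt_one.trans_le hu1
  have hn0 : (0 : ℝ) < n := by exact_mod_cast hu.trans hun
  have hsqrt : 1152 * connectiveConstant ^ 4 ≤ (u : ℝ) ^ (1 / 2 : ℝ) := by
    rw [← Real.sqrt_eq_rpow]
    refine Real.le_sqrt_of_sq_le (hC.trans ?_)
    exact_mod_cast (by omega : C ≤ u)
  have hnu' : (u : ℝ) ^ (-(17 / 8) : ℝ) ≤ (n : ℝ) ^ (-(17 / 16) : ℝ) := by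
    calc (u : ℝ) ^ (-(17 / 8) : ℝ) = ((u : ℝ) ^ 2) ^ (-(17 / 16) : ℝ) := by
          rw [← Real.rpow_natCast_mul hu0.le]
          norm_num
      _ ≤ (n : ℝ) ^ (-(17 / 16) : ℝ) :=
          Real.rpow_le_rpow_of_nonpos hn0 (by exact_mod_cast hnu) (by norm_num)
  have hb4 : (u : ℝ) ^ (-(17 / 2) : ℝ) * connectiveConstant ^ (4 * n) ≤
      1152 * (u : ℝ) ^ 20 * ((WSAP (4 * n + 4) u).ncard : ℝ) := by
    calc (u : ℝ) ^ (-(17 / 2) : ℝ) * connectiveConstant ^ (4 * n)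
        = ((u : ℝ) ^ (-(17 / 8) : ℝ) * connectiveConstant ^ n) ^ 4 := by
          rw [mul_pow, ← Real.rpow_mul_natCast hu0.le, ← pow_mul, mul_comm n]
          norm_num
      _ ≤ ({γ | IsBridge n γ}.ncard : ℝ) ^ 4 :=
          pow_le_pow_left₀ (by positivity)
            ((mul_le_mul_of_nonneg_right hnu' (by positivity)).trans hnb) 4
      _ ≤ _ := by exact_mod_cast hW
  have hexp : (u : ℝ) ^ (-(17 / 2) : ℝ) =
      (u : ℝ) ^ (-29 : ℝ) * (u : ℝ) ^ (1 / 2 : ℝ) * (u : ℝ) ^ 20 := by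
    rw [← Real.rpow_natCast, ← Real.rpow_add hu0, ← Real.rpow_add hu0]
    norm_num
  have hα' : (u : ℝ) ^ (-α) ≤ (u : ℝ) ^ (-29 : ℝ) :=
    Real.rpow_le_rpow_of_exponent_le hu1 (by linarith)
  have hpos : (0 : ℝ) < 1152 * (u : ℝ) ^ 20 := by positivity
  refine le_of_mul_le_mul_left (le_trans ?_ hb4) hpos
  rw [hexp, pow_add]
  calc 1152 * (u : ℝ) ^ 20 *
        ((u : ℝ) ^ (-α) * (connectiveConstant ^ (4 * n) * connectiveConstant ^ 4))
      = (u : ℝ) ^ (-α) * (1152 * connectiveConstant ^ 4) * (u : ℝ) ^ 20 *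
          connectiveConstant ^ (4 * n) := by ring
    _ ≤ _ := by gcongr

end SquareLattice

theorem proposition3p1 (α : ℝ) (hα : 29 < α) :
    ∃ A : Set ℕ, A.Infinite ∧ ∀ u ∈ A, 0 < u ∧
      ∃ m ∈ Set.Icc (4 * u + 4) (4 * u ^ 2 + 4), Even m ∧
        (u : ℝ) ^ (-α) * SquareLattice.connectiveConstant ^ m ≤
          ((SquareLattice.WSAP m u).ncard : ℝ) :=
  SquareLattice.exists_infinite_le_ncard_WSAP α hα
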